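/- Let $a,b,c\in\mathbb{R}$ be such that the binary quadratic form $ax^2+bxy+cy^2$ is positive definite, with discriminant $d:=b^2-4ac<0$. For $n\ge 1$ put $$G_n:=\sum_{j,k=1}^{n-1}\Big(\frac{1}{aj^2-bjk+ck^2}+\frac{1}{aj^2+bjk+ck^2}\Big).$$ Then, as $n\to\infty$ with $a,b,c$ fixed, $$\begin{aligned} G_n={}&\frac{2\pi}{\sqrt{|d|}}\log n+\bigg[\frac{2\pi}{\sqrt{|d|}}\gamma-\frac{\pi^2}{6}\Big(\frac1a+\frac1c\Big)-\frac{4\pi}{\sqrt{|d|}}\log|\eta(\mu)|\\ &\qquad+\frac{1}{\sqrt{|d|}}\bigg(\Big(\frac{\pi}{2}-\arctan\Big(\frac{c-a}{\sqrt{|d|}}\Big)\Big)\log\Big(\frac ca\Big)-C(a,b,c)\bigg)\bigg]\\ &+\bigg[\frac1a+\frac1c-\frac{\pi}{\sqrt{|d|}}\bigg]\frac1n+\bigg[\frac12\Big(\frac1a+\frac1c\Big)+\frac1{12}\Big(\frac1{a-b+c}+\frac1{a+b+c}\Big)-\frac{\pi}{6\sqrt{|d|}}\bigg]\frac1{n^2}\\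 &+\bigg[\frac16\Big(\frac1a+\frac1c\Big)+\frac1{12}\Big(\frac1{a-b+c}+\frac1{a+b+c}\Big)\bigg]\frac1{n^3}+\mathcal{O}\Big(\frac{\log n}{n^4}\Big), \end{aligned}$$ where $\gamma$ is Euler's constant, $\mu=\dfrac{-b+i\sqrt{|d|}}{2c}$, $\eta(\tau)=e^{\pi i\tau/12}\prod_{m=1}^\infty(1-e^{2\pi i m\tau})$ (for $\Im\tau>0$) is the Dedekind eta-function, and, with the Clausen function $\mathrm{Cl}_2(\theta)=\sum_{k=1}^\infty \frac{\sin k\theta}{k^2}$, $$\begin{aligned} C(a,b,c):={}&\mathrm{Cl}_2\Big(\pi-2\arctan\Big(\frac{2a-b}{\sqrt{|d|}}\Big)\Big)+\mathrm{Cl}_2\Big(\pi-2\arctan\Big(\frac{2a+b}{\sqrt{|d|}}\Big)\Big)\\ &+\mathrm{Cl}_2\Big(\pi-2\arctan\Big(\frac{2c-b}{\sqrt{|d|}}\Big)\Big)+\mathrm{Cl}_2\Big(\pi-2\arctan\Big(\frac{2c+b}{\sqrt{|d|}}\Big)\Big). \end{aligned}$$ -/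

import Mathlib

namespace QuadFormSum

noncomputable section

/-- The binary quadratic form `a x² + b x y + c y²`. -/
def form (a b c x y : ℝ) : ℝ := a * x ^ 2 + b * x * y + c * y ^ 2

/-- Positive definiteness of `a x² + b x y + c y²` on `ℝ²`. -/
def IsPosDef (a b c : ℝ) : Prop :=
  ∀ x y : ℝ, (x, y) ≠ (0, 0) → 0 < form a b c x y

/-- The discriminant of the form. -/
def disc (a b c : ℝ) : ℝ := b ^ 2 - 4 * a * c

/-- `G_n = ∑_{j,k=1}^{n-1} (1/(aj² - bjk + ck²) + 1/(aj² + bjk + ck²))`. -/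
def G (a b c : ℝ) (n : ℕ) : ℝ :=
  ∑ j ∈ Finset.Ico 1 n, ∑ k ∈ Finset.Ico 1 n,
    (1 / (a * (j : ℝ) ^ 2 - b * (j : ℝ) * (k : ℝ) + c * (k : ℝ) ^ 2)
      + 1 / (a * (j : ℝ) ^ 2 + b * (j : ℝ) * (k : ℝ) + c * (k : ℝ) ^ 2))

/-- The Clausen function `Cl₂(θ) = ∑_{k ≥ 1} sin(kθ) / k²`. -/
def clausen (θ : ℝ) : ℝ :=
  ∑' k : ℕ, Real.sin (((k : ℝ) + 1) * θ) / ((k : ℝ) + 1) ^ 2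

/-- The point `μ = (-b + i √|d|) / (2c)`. -/
def mu (a b c : ℝ) : ℂ :=
  (-(b : ℂ) + (Real.sqrt |disc a b c| : ℂ) * Complex.I) / (2 * (c : ℂ))

/-- The combination `C(a,b,c)` of Clausen function values. -/
def clausenSum (a b c : ℝ) : ℝ :=
  clausen (Real.pi - 2 * Real.arctan ((2 * a - b) / Real.sqrt |disc a b c|))
    + clausen (Real.pi - 2 * Real.arctan ((2 * a + b) / Real.sqrt |disc a b c|))
    + clausen (Real.pi - 2 * Real.arctan ((2 * c - b) / Real.sqrt |disc a b c|))
    + clausen (Real.pi - 2 * Real.arctan ((2 * c + b) / Real.sqrt |disc a b c|))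

/-- The constant term of the expansion. -/
def coeff0 (a b c : ℝ) : ℝ :=
  2 * Real.pi / Real.sqrt |disc a b c| * Real.eulerMascheroniConstant
    - Real.pi ^ 2 / 6 * (1 / a + 1 / c)
    - 4 * Real.pi / Real.sqrt |disc a b c| * Real.log ‖ModularForm.eta (mu a b c)‖
    + 1 / Real.sqrt |disc a b c|
      * ((Real.pi / 2 - Real.arctan ((c - a) / Real.sqrt |disc a b c|)) * Real.log (c / a)
          - clausenSum a b c)

/-- The coefficient of `1/n`. -/
def coeff1 (a b c : ℝ) : ℝ :=
  1 / a + 1 / c - Real.pi / Real.sqrt |disc a b c|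

/-- The coefficient of `1/n²`. -/
def coeff2 (a b c : ℝ) : ℝ :=
  1 / 2 * (1 / a + 1 / c) + 1 / 12 * (1 / (a - b + c) + 1 / (a + b + c))
    - Real.pi / (6 * Real.sqrt |disc a b c|)

/-- The coefficient of `1/n³`. -/
def coeff3 (a b c : ℝ) : ℝ :=
  1 / 6 * (1 / a + 1 / c) + 1 / 12 * (1 / (a - b + c) + 1 / (a + b + c))

end

end QuadFormSum

namespace QuadFormSum

open Filter Topology Set

/-! ### The Clausen function -/

/-! Write `s = √|d|`, so that `s² = 4ac - b²`. The nonconstant terms come from increments, the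
constant from a limit.

Passing from `n` to `n + 1` adds the border of the square: four edge sums and a corner
(`G_succ_sub`). By homogeneity each edge sum is a Riemann sum of a fixed smooth function on `[0,
1]`, and the corrected trapezoidal rule gives it up to `O(n⁻⁵)`. The coefficients of `log n`, `1/n`,
`1/n²`, `1/n³` are exactly those that reproduce these increments. The remainder therefore has
increments `O(n⁻⁵)`, and once it is known to converge it does so at rate `O(n⁻⁴)`.

For the limit, the square is compared with the strip `1 ≤ j < n`, `k ≥ 1`. Since `aj² + bjk + ck² =
c|jμ - k|²`, a full column sum is the imaginary part of the partial fraction series of `π cot(πjμ)`.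
Summation over `j` yields harmonic numbers (hence `log n` and `γ`), `ζ(2)`, and a Lambert series in
`exp(2πiμ)` equal to `-∑ log|1 - q^m|`, hence `log|η(μ)|`. The excess part `k ≥ n` of the strip is,
up to `O(1/n)`, a Riemann sum for the integral over `[0, 1]` of an arctangent sum divided by `x`.
Its primitive is built from Clausen functions (`hasDerivAt_clausenPrimitive`), whose values at `1`
give `C(a,b,c)`. -/

theorem summable_inv_succ_sq : Summable fun k : ℕ => 1 / ((k : ℝ) + 1) ^ 2 := by
  have := (summable_nat_add_iff 1).2 (Real.summable_one_div_nat_pow.2 (one_lt_two))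
  simpa using this

theorem abs_sin_div_succ_sq_le (k : ℕ) (θ : ℝ) :
    ‖Real.sin (((k : ℝ) + 1) * θ) / ((k : ℝ) + 1) ^ 2‖ ≤ 1 / ((k : ℝ) + 1) ^ 2 := by
  rw [norm_div, Real.norm_eq_abs, Real.norm_of_nonneg (by positivity : 0 ≤ ((k : ℝ) + 1) ^ 2)]
  gcongr
  exact Real.abs_sin_le_one _

theorem continuous_clausen : Continuous clausen :=
  continuous_tsum (fun k => by fun_prop) summable_inv_succ_sq abs_sin_div_succ_sq_le

theorem clausen_zero : clausen 0 = 0 := by simp [clausen]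

theorem clausen_neg (θ : ℝ) : clausen (-θ) = -clausen θ := by
  simp [clausen, neg_div, tsum_neg]

theorem clausen_add_two_pi (θ : ℝ) : clausen (θ + 2 * Real.pi) = clausen θ := by
  unfold clausen
  refine tsum_congr fun k => ?_
  rw [show ((k : ℝ) + 1) * (θ + 2 * Real.pi) = ((k : ℝ) + 1) * θ + ((k + 1 : ℕ) : ℝ) * (2 * Real.pi)
    by push_cast; ring, Real.sin_add_nat_mul_two_pi]

theorem clausen_pi_sub_add_clausen_pi_add (t : ℝ) :
    clausen (Real.pi - t) + clausen (Real.pi + t) = 0 := by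
  have := clausen_add_two_pi (-(Real.pi - t))
  rw [clausen_neg, show -(Real.pi - t) + 2 * Real.pi = Real.pi + t by ring] at this
  linarith

/-- The Abel means of the Clausen series. -/
noncomputable def clausenAbel (r θ : ℝ) : ℝ :=
  ∑' k : ℕ, r ^ (k + 1) * (Real.sin (((k : ℝ) + 1) * θ) / ((k : ℝ) + 1) ^ 2)

theorem hasSum_pow_mul_cos_div (r θ : ℝ) (h0 : 0 ≤ r) (h1 : r < 1) :
    HasSum (fun k : ℕ => r ^ (k + 1) * (Real.cos (((k : ℝ) + 1) * θ) / ((k : ℝ) + 1)))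
      (-Real.log ‖1 - (r : ℂ) * Complex.exp (θ * Complex.I)‖) := by
  have hz : ‖(r : ℂ) * Complex.exp (θ * Complex.I)‖ < 1 := by
    rw [norm_mul, Complex.norm_exp_ofReal_mul_I, mul_one, Complex.norm_real,
      Real.norm_of_nonneg h0]
    exact h1
  have h := Complex.hasSum_re (Complex.hasSum_taylorSeries_neg_log hz)
  -- The term of index `0` is `z ^ 0 / 0 = 0`, so the shift costs nothing.
  rw [← hasSum_nat_add_iff' 1] at h
  simp only [Finset.range_one, Finset.sum_singleton, pow_zero, Nat.cast_zero, div_zero,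
    Complex.zero_re, sub_zero, Complex.neg_re, Complex.log_re] at h
  refine h.congr_fun fun k => ?_
  rw [mul_pow, ← Complex.exp_nat_mul, ← Complex.ofReal_pow,
    show ((k + 1 : ℕ) : ℂ) * (θ * Complex.I) = ((((k : ℝ) + 1) * θ : ℝ) : ℂ) * Complex.I by
      push_cast; ring,
    show ((k + 1 : ℕ) : ℂ) = (((k : ℝ) + 1 : ℝ) : ℂ) by push_cast; ring,
    mul_div_assoc, Complex.re_ofReal_mul, Complex.div_ofReal_re, Complex.exp_ofReal_mul_I_re]

theorem hasDerivAt_clausenAbel (r θ : ℝ) (h0 : 0 ≤ r) (h1 : r < 1) :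
    HasDerivAt (clausenAbel r) (-Real.log ‖1 - (r : ℂ) * Complex.exp (θ * Complex.I)‖) θ := by
  rw [← (hasSum_pow_mul_cos_div r θ h0 h1).tsum_eq]
  have hu : Summable fun k : ℕ => r ^ (k + 1) :=
    (summable_nat_add_iff 1).2 (summable_geometric_of_lt_one h0 h1)
  refine hasDerivAt_tsum
    (g := fun (k : ℕ) (y : ℝ) =>
      r ^ (k + 1) * (Real.sin (((k : ℝ) + 1) * y) / ((k : ℝ) + 1) ^ 2))
    (g' := fun (k : ℕ) (y : ℝ) => r ^ (k + 1) * (Real.cos (((k : ℝ) + 1) * y) / ((k : ℝ) + 1)))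
    (y₀ := 0) hu (fun k y => ?_) (fun k y => ?_) ?_ θ
  · have : HasDerivAt (fun y : ℝ => Real.sin (((k : ℝ) + 1) * y))
        (Real.cos (((k : ℝ) + 1) * y) * ((k : ℝ) + 1)) y := by
      simpa using (((hasDerivAt_id y).const_mul ((k : ℝ) + 1)).sin)
    refine ((this.div_const (((k : ℝ) + 1) ^ 2)).const_mul (r ^ (k + 1))).congr_deriv ?_
    field_simp
  · have hk : (1 : ℝ) ≤ (k : ℝ) + 1 := by linarith [(Nat.cast_nonneg k : (0 : ℝ) ≤ k)]
    rw [norm_mul, norm_pow, Real.norm_of_nonneg h0, norm_div, Real.norm_of_nonneg (by positivity :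
      0 ≤ (k : ℝ) + 1)]
    refine mul_le_of_le_one_right (by positivity) (div_le_one_of_le₀ ?_ (by positivity))
    exact (Real.abs_cos_le_one _).trans hk
  · simp [summable_zero]

theorem tendsto_clausenAbel (θ : ℝ) :
    Tendsto (fun r => clausenAbel r θ) (𝓝[<] 1) (𝓝 (clausen θ)) := by
  refine tendsto_tsum_of_dominated_convergence summable_inv_succ_sq (fun k => ?_) ?_
  · have : Continuous fun r : ℝ => r ^ (k + 1) * (Real.sin (((k : ℝ) + 1) * θ) / ((k : ℝ) + 1) ^ 2) := by
      fun_prop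
    simpa using (this.tendsto 1).mono_left nhdsWithin_le_nhds
  · filter_upwards [Ioo_mem_nhdsLT (zero_lt_one (α := ℝ))] with r hr k
    rw [norm_mul]
    refine (mul_le_of_le_one_left (norm_nonneg _) ?_).trans (abs_sin_div_succ_sq_le k θ)
    rw [norm_pow, Real.norm_of_nonneg hr.1.le]
    exact pow_le_one₀ hr.1.le hr.2.le

/-- The differentiated series `∑ cos(kθ)/k` is not absolutely convergent, so the derivative is taken
on the Abel means. Their derivatives converge uniformly near `θ` as `r → 1⁻`, because `log ‖1 - r
e^{iθ}‖` is jointly continuous where `e^{iθ} ≠ 1`. -/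
theorem hasDerivAt_clausen {θ : ℝ} (h0 : 0 < θ) (h1 : θ < 2 * Real.pi) :
    HasDerivAt clausen (-Real.log (2 * Real.sin (θ / 2))) θ := by
  have hsin : 0 < Real.sin (θ / 2) := Real.sin_pos_of_pos_of_lt_pi (by linarith) (by linarith)
  have hnorm : ‖1 - ((1 : ℝ) : ℂ) * Complex.exp (θ * Complex.I)‖ = 2 * Real.sin (θ / 2) := by
    rw [Complex.ofReal_one, one_mul, norm_sub_rev, mul_comm, Complex.norm_exp_I_mul_ofReal_sub_one,
      Real.norm_of_nonneg (by positivity)]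
  let F : ℝ → ℝ → ℝ := fun r t => -Real.log ‖1 - (r : ℂ) * Complex.exp (t * Complex.I)‖
  have hcont : ContinuousAt (fun p : ℝ × ℝ => F p.1 p.2) (1, θ) := by
    refine ((ContinuousAt.log ?_ ?_)).neg
    · fun_prop
    · change ‖1 - ((1 : ℝ) : ℂ) * Complex.exp (θ * Complex.I)‖ ≠ 0
      rw [hnorm]; positivity
  have hle : (𝓝[<] (1 : ℝ)) ×ˢ 𝓝 θ ≤ 𝓝 ((1 : ℝ), θ) := by
    rw [nhds_prod_eq]
    exact Filter.prod_mono nhdsWithin_le_nhds le_rfl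
  rw [← hnorm]
  refine hasDerivAt_of_tendstoUniformlyOnFilter (l := 𝓝[<] (1 : ℝ)) (f := clausenAbel) (f' := F)
    (g' := F 1) ?_ ?_ (Eventually.of_forall tendsto_clausenAbel)
  · rw [tendstoUniformlyOnFilter_iff_tendsto]
    have hl : Tendsto (fun q : ℝ × ℝ => F 1 q.2) ((𝓝[<] (1 : ℝ)) ×ˢ 𝓝 θ) (𝓝 (F 1 θ)) := by
      have : ContinuousAt (F 1) θ :=
        ContinuousAt.comp (f := fun t : ℝ => ((1 : ℝ), t)) (x := θ) hcont (by fun_prop)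
      exact this.tendsto.comp tendsto_snd
    have hr : Tendsto (fun q : ℝ × ℝ => F q.1 q.2) ((𝓝[<] (1 : ℝ)) ×ˢ 𝓝 θ) (𝓝 (F 1 θ)) :=
      hcont.tendsto.mono_left hle
    exact (hl.prodMk_nhds hr).mono_right (nhds_le_uniformity _)
  · have : ∀ᶠ r in 𝓝[<] (1 : ℝ), r ∈ Ioo (0 : ℝ) 1 := Ioo_mem_nhdsLT zero_lt_one
    filter_upwards [this.prod_inl (𝓝 θ)] with q hq
    exact hasDerivAt_clausenAbel q.1 q.2 hq.1.le hq.2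

/-! ### Sums, integrals and telescoping -/

theorem abs_le_mul_of_hasDerivAt {f f' : ℝ → ℝ} (hf : ∀ x, HasDerivAt f (f' x) x) (h0 : f 0 = 0)
    {B δ : ℝ} (hB : ∀ x ∈ Icc 0 δ, |f' x| ≤ B) {x : ℝ} (hx : x ∈ Icc 0 δ) : |f x| ≤ B * δ := by
  have hB0 : 0 ≤ B := (abs_nonneg _).trans (hB x hx)
  have := norm_image_sub_le_of_norm_deriv_le_segment' (f := f) (f' := f') (a := 0) (b := δ) (C := B)
    (fun y _ => (hf y).hasDerivWithinAt) (fun y hy => hB y ⟨hy.1, hy.2.le⟩) x hx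
  rw [h0, sub_zero, sub_zero, Real.norm_eq_abs] at this
  exact this.trans (by gcongr; exact hx.2)

/-- The corrected trapezoidal rule on a single panel. -/
theorem abs_corrected_trapezoid_panel_le {P : ℕ → ℝ → ℝ}
    (hP : ∀ i x, HasDerivAt (P i) (P (i + 1) x) x) {M x δ : ℝ} (hδ : 0 ≤ δ)
    (hM : ∀ y ∈ Icc x (x + δ), |P 5 y| ≤ M) :
    |P 0 (x + δ) - P 0 x - δ / 2 * (P 1 x + P 1 (x + δ)) + δ ^ 2 / 12 * (P 2 (x + δ) - P 2 x)|
      ≤ M * δ ^ 5 := by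
  have hPs : ∀ i t, HasDerivAt (fun t => P i (x + t)) (P (i + 1) (x + t)) t := fun i t =>
    (hP i (x + t)).comp_const_add x t
  have hM0 : 0 ≤ M := (abs_nonneg _).trans (hM x ⟨le_rfl, by linarith⟩)
  -- The error is regarded as a function of the panel width `t`. It and its first two derivatives
  -- vanish at `t = 0`, and its third derivative is `t² P⁽⁵⁾/12`. Three integrations turn the bound
  -- `M δ²` into `M δ⁵`.
  let Q0 : ℝ → ℝ := fun t =>
    P 0 (x + t) - P 0 x - t / 2 * (P 1 x + P 1 (x + t)) + t ^ 2 / 12 * (P 2 (x + t) - P 2 x)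
  let Q1 : ℝ → ℝ := fun t => P 1 (x + t) / 2 - P 1 x / 2 - t / 2 * P 2 (x + t)
    + t / 6 * (P 2 (x + t) - P 2 x) + t ^ 2 / 12 * P 3 (x + t)
  let Q2 : ℝ → ℝ := fun t => (P 2 (x + t) - P 2 x) / 6 - t / 6 * P 3 (x + t)
    + t ^ 2 / 12 * P 4 (x + t)
  let Q3 : ℝ → ℝ := fun t => t ^ 2 / 12 * P 5 (x + t)
  have hid : ∀ t : ℝ, ∀ r : ℝ, HasDerivAt (fun t : ℝ => t / r) (1 / r) t := fun t r =>
    (hasDerivAt_id t).div_const r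
  have hsq : ∀ t : ℝ, HasDerivAt (fun t : ℝ => t ^ 2 / 12) (t / 6) t := fun t => by
    refine ((hasDerivAt_pow 2 t).div_const 12).congr_deriv ?_
    norm_num; ring
  have h0 : ∀ t, HasDerivAt Q0 (Q1 t) t := fun t => by
    refine ((((hPs 0 t).sub_const (P 0 x)).sub ((hid t 2).mul ((hPs 1 t).const_add (P 1 x)))).add
      ((hsq t).mul ((hPs 2 t).sub_const (P 2 x)))).congr_deriv ?_
    simp only [Q1]; ring
  have h1 : ∀ t, HasDerivAt Q1 (Q2 t) t := fun t => by
    refine ((((((hPs 1 t).div_const 2).sub_const (P 1 x / 2)).sub ((hid t 2).mul (hPs 2 t))).add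
      ((hid t 6).mul ((hPs 2 t).sub_const (P 2 x)))).add ((hsq t).mul (hPs 3 t))).congr_deriv ?_
    simp only [Q2]; ring
  have h2 : ∀ t, HasDerivAt Q2 (Q3 t) t := fun t => by
    refine (((((hPs 2 t).sub_const (P 2 x)).div_const 6).sub ((hid t 6).mul (hPs 3 t))).add
      ((hsq t).mul (hPs 4 t))).congr_deriv ?_
    simp only [Q3]; ring
  have b3 : ∀ t ∈ Icc 0 δ, |Q3 t| ≤ M * δ ^ 2 := fun t ht => by
    have hPt := hM (x + t) ⟨by linarith [ht.1], by linarith [ht.2]⟩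
    have ht2 : t ^ 2 ≤ δ ^ 2 := pow_le_pow_left₀ ht.1 ht.2 2
    simp only [Q3]
    rw [abs_mul, abs_of_nonneg (by positivity), mul_comm M]
    exact mul_le_mul (by linarith [sq_nonneg t]) hPt (abs_nonneg _) (by positivity)
  have b2 := fun t ht => abs_le_mul_of_hasDerivAt h2 (by simp [Q2]) b3 (x := t) ht
  have b1 := fun t ht => abs_le_mul_of_hasDerivAt h1 (by simp [Q1]) b2 (x := t) ht
  have b0 := abs_le_mul_of_hasDerivAt h0 (by simp [Q0]) b1 (x := δ) ⟨hδ, le_rfl⟩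
  calc _ ≤ _ := b0
    _ = M * δ ^ 5 := by ring

theorem sum_range_add_succ (u : ℕ → ℝ) {n : ℕ} (hn : 1 ≤ n) :
    ∑ k ∈ Finset.range n, (u k + u (k + 1)) = 2 * ∑ k ∈ Finset.Ico 1 n, u k + u 0 + u n := by
  induction n, hn using Nat.le_induction with
  | base => simp
  | succ n hn ih => rw [Finset.sum_range_succ, ih, Finset.sum_Ico_succ_top hn]; ring

/-- The corrected composite trapezoidal rule on `[0, 1]`. -/
theorem exists_abs_corrected_trapezoid_le {P : ℕ → ℝ → ℝ}
    (hP : ∀ i x, HasDerivAt (P i) (P (i + 1) x) x) :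
    ∃ M : ℝ, ∀ n : ℕ, 1 ≤ n →
      |P 0 1 - P 0 0 - 1 / n * (∑ k ∈ Finset.Ico 1 n, P 1 (k / n) + (P 1 0 + P 1 1) / 2)
        + (P 2 1 - P 2 0) / (12 * (n : ℝ) ^ 2)| ≤ M / (n : ℝ) ^ 4 := by
  have hcont : ContinuousOn (P 5) (Icc 0 1) := fun x _ =>
    (hP 5 x).continuousAt.continuousWithinAt
  obtain ⟨M, hM⟩ := isCompact_Icc.exists_bound_of_continuousOn hcont
  refine ⟨M, fun n hn => ?_⟩
  have hn0 : (0 : ℝ) < n := by exact_mod_cast hn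
  have key : ∀ k ∈ Finset.range n,
      |P 0 ((k + 1 : ℕ) / n) - P 0 (k / n)
        - 1 / (2 * n) * (P 1 (k / n) + P 1 ((k + 1 : ℕ) / n))
        + 1 / (12 * (n : ℝ) ^ 2) * (P 2 ((k + 1 : ℕ) / n) - P 2 (k / n))| ≤ M / (n : ℝ) ^ 5 := by
    intro k hk
    have hk' : ((k + 1 : ℕ) : ℝ) ≤ n := by exact_mod_cast Finset.mem_range.1 hk
    have hx : ((k + 1 : ℕ) : ℝ) / n = k / n + 1 / n := by push_cast; ring
    have := abs_corrected_trapezoid_panel_le hP (M := M) (x := k / n) (δ := 1 / n) (by positivity)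
      (fun y hy => hM y ⟨le_trans (by positivity) hy.1, hy.2.trans (by
        rw [← hx]; exact div_le_one_of_le₀ hk' hn0.le)⟩)
    rw [hx]
    refine le_of_eq_of_le (congrArg abs ?_) (this.trans_eq ?_) <;> ring
  have hsum := (Finset.abs_sum_le_sum_abs _ _).trans (Finset.sum_le_sum key)
  rw [Finset.sum_const, Finset.card_range, nsmul_eq_mul, Finset.sum_add_distrib,
    Finset.sum_sub_distrib, ← Finset.mul_sum, ← Finset.mul_sum,
    Finset.sum_range_sub (fun k : ℕ => P 0 ((k : ℝ) / n)),
    Finset.sum_range_sub (fun k : ℕ => P 2 ((k : ℝ) / n)),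
    sum_range_add_succ (fun k : ℕ => P 1 ((k : ℝ) / n)) hn] at hsum
  simp only [Nat.cast_zero, zero_div, div_self hn0.ne'] at hsum
  refine le_of_eq_of_le (congrArg abs ?_) (hsum.trans_eq ?_)
  · field_simp; ring
  · field_simp

/-- Riemann sums of a continuous derivative converge to the increment. -/
theorem tendsto_riemann_sum {F m : ℝ → ℝ} (hF : ContinuousOn F (Icc 0 1))
    (hm : ContinuousOn m (Icc 0 1)) (hd : ∀ x ∈ Ioo (0 : ℝ) 1, HasDerivAt F (m x) x) :
    Tendsto (fun n : ℕ => 1 / (n : ℝ) * ∑ j ∈ Finset.range n, m (j / n)) atTop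
      (𝓝 (F 1 - F 0)) := by
  have huc := isCompact_Icc.uniformContinuousOn_of_continuous hm
  rw [Metric.uniformContinuousOn_iff] at huc
  rw [Metric.tendsto_atTop]
  intro ε hε
  obtain ⟨δ, hδ, h⟩ := huc (ε / 2) (by positivity)
  obtain ⟨N, hN⟩ := exists_nat_gt (1 / δ)
  refine ⟨N + 1, fun n hn => ?_⟩
  have hn1 : 1 ≤ n := by omega
  have hn0 : (0 : ℝ) < n := by exact_mod_cast hn1
  have hnδ : 1 / (n : ℝ) < δ := by
    rw [div_lt_comm₀ hn0 hδ]
    exact hN.trans_le (by exact_mod_cast (by omega : N ≤ n))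
  have key : ∀ j ∈ Finset.range n,
      |1 / (n : ℝ) * m (j / n) - (F ((j + 1 : ℕ) / n) - F (j / n))| ≤ 1 / n * (ε / 2) := by
    intro j hj
    have hj' : ((j + 1 : ℕ) : ℝ) ≤ n := by exact_mod_cast Finset.mem_range.1 hj
    have hx0 : (0 : ℝ) ≤ j / n := by positivity
    have hx1 : ((j + 1 : ℕ) : ℝ) / n ≤ 1 := div_le_one_of_le₀ hj' hn0.le
    have hxx : ((j + 1 : ℕ) : ℝ) / n - j / n = 1 / n := by push_cast; ring
    have hlt : (j : ℝ) / n < (j + 1 : ℕ) / n := by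
      have : (0 : ℝ) < 1 / n := by positivity
      linarith
    -- The mean value theorem needs differentiability only in the open interval, which matters
    -- because the primitive used later contains `x log x`.
    obtain ⟨ξ, hξ, hξ'⟩ := exists_hasDerivAt_eq_slope F m hlt
      (hF.mono (Icc_subset_Icc hx0 hx1))
      (fun x hx => hd x ⟨hx0.trans_lt hx.1, hx.2.trans_le hx1⟩)
    rw [hxx, eq_div_iff (by positivity)] at hξ'
    rw [← hξ', mul_comm (m ξ), ← mul_sub, abs_mul, abs_of_pos (by positivity : (0 : ℝ) < 1 / n)]
    gcongr
    refine (h _ ⟨hx0, hlt.le.trans hx1⟩ _ ⟨hx0.trans hξ.1.le, hξ.2.le.trans hx1⟩ ?_).le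
    rw [Real.dist_eq, abs_sub_comm, abs_of_pos (by linarith [hξ.1])]
    linarith [hξ.2]
  have hsum := (Finset.abs_sum_le_sum_abs _ _).trans (Finset.sum_le_sum key)
  rw [Finset.sum_const, Finset.card_range, nsmul_eq_mul, Finset.sum_sub_distrib, ← Finset.mul_sum,
    Finset.sum_range_sub (fun k : ℕ => F ((k : ℝ) / n))] at hsum
  simp only [Nat.cast_zero, zero_div, div_self hn0.ne'] at hsum
  rw [Real.dist_eq]
  refine hsum.trans_lt ?_
  rw [← mul_assoc, mul_one_div_cancel hn0.ne', one_mul]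
  linarith

/-- A convergent sequence with increments `O(n⁻⁵)` approaches its limit at rate `O(n⁻⁴)`. -/
theorem isBigO_sub_of_tendsto_of_isBigO_increment {E : ℕ → ℝ} {K : ℝ}
    (hE : Tendsto E atTop (𝓝 K))
    (hinc : (fun n => E (n + 1) - E n) =O[atTop] fun n : ℕ => 1 / (n : ℝ) ^ 5) :
    (fun n => E n - K) =O[atTop] fun n : ℕ => 1 / (n : ℝ) ^ 4 := by
  obtain ⟨C, hC0, hC⟩ := hinc.exists_pos
  rw [Asymptotics.isBigOWith_iff, eventually_atTop] at hC
  obtain ⟨N, hN⟩ := hC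
  -- A telescoping majorant: the difference on the right is at least `4n³ / (16n⁸)`, so `32` is a
  -- generous constant.
  have step : ∀ n : ℕ, 1 ≤ n →
      1 / (n : ℝ) ^ 5 ≤ 32 * (1 / (n : ℝ) ^ 4 - 1 / ((n + 1 : ℕ) : ℝ) ^ 4) := by
    intro n hn
    have hn1 : (1 : ℝ) ≤ n := by exact_mod_cast hn
    push_cast
    rw [div_sub_div _ _ (by positivity) (by positivity), mul_div_assoc', div_le_div_iff₀
      (by positivity) (by positivity)]
    have : (n : ℝ) + 1 ≤ 2 * n := by linarith
    have h4 : ((n : ℝ) + 1) ^ 4 ≤ 16 * (n : ℝ) ^ 4 := by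
      calc ((n : ℝ) + 1) ^ 4 ≤ (2 * n) ^ 4 := by gcongr
        _ = _ := by ring
    have h5 : 4 * (n : ℝ) ^ 3 ≤ ((n : ℝ) + 1) ^ 4 - n ^ 4 := by
      have : ((n : ℝ) + 1) ^ 4 - n ^ 4 - 4 * (n : ℝ) ^ 3 = 6 * (n : ℝ) ^ 2 + 4 * n + 1 := by ring
      have : 0 ≤ 6 * (n : ℝ) ^ 2 + 4 * n + 1 := by positivity
      linarith
    calc 1 * ((n : ℝ) ^ 4 * (n + 1) ^ 4) ≤ (n : ℝ) ^ 4 * (16 * (n : ℝ) ^ 4) := by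
          rw [one_mul]; gcongr
      _ ≤ 32 * (4 * (n : ℝ) ^ 3) * n ^ 5 := by
          have : 0 ≤ (n : ℝ) ^ 8 := by positivity
          linarith [show (n : ℝ) ^ 4 * (16 * (n : ℝ) ^ 4) = 16 * n ^ 8 by ring,
            show 32 * (4 * (n : ℝ) ^ 3) * n ^ 5 = 128 * n ^ 8 by ring]
      _ ≤ 32 * (1 * ((n : ℝ) + 1) ^ 4 - n ^ 4 * 1) * n ^ 5 := by
          gcongr
          linarith
  refine Asymptotics.IsBigO.of_bound (C * 32) ?_
  filter_upwards [eventually_ge_atTop (max N 1)] with n hn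
  have hnN : N ≤ n := le_trans (le_max_left _ _) hn
  have hn1 : 1 ≤ n := le_trans (le_max_right _ _) hn
  have partialBound : ∀ m, n ≤ m →
      |E n - E m| ≤ C * 32 * (1 / (n : ℝ) ^ 4 - 1 / (m : ℝ) ^ 4) := by
    intro m hm
    induction m, hm using Nat.le_induction with
    | base => simp
    | succ m hm ih =>
      have h1 := hN m (hnN.trans hm)
      rw [Real.norm_eq_abs, Real.norm_of_nonneg (by positivity)] at h1
      have h2 := mul_le_mul_of_nonneg_left (step m (hn1.trans hm)) hC0.le
      have h3 := abs_sub_le (E n) (E m) (E (m + 1))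
      rw [abs_sub_comm (E m)] at h3
      linarith
  have hlim : Tendsto (fun m => |E n - E m|) atTop (𝓝 |E n - K|) :=
    (tendsto_const_nhds.sub hE).abs
  rw [Real.norm_eq_abs, Real.norm_of_nonneg (by positivity)]
  refine le_of_tendsto hlim ?_
  filter_upwards [eventually_ge_atTop n] with m hm
  refine (partialBound m hm).trans ?_
  have : (0 : ℝ) ≤ 1 / (m : ℝ) ^ 4 := by positivity
  gcongr
  linarith

/-! ### Row sums -/

/-- The difference lies in `(0, π)`. Taking the tangent of its complement to `π/2` avoids a case
split on the sign of `1 + u * v`. -/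
theorem arctan_sub_arctan {u v : ℝ} (huv : v < u) :
    Real.arctan u - Real.arctan v = Real.pi / 2 - Real.arctan ((1 + u * v) / (u - v)) := by
  have hlt : Real.arctan v < Real.arctan u := Real.arctan_strictMono huv
  have hu := Real.arctan_lt_pi_div_two u
  have hv := Real.neg_pi_div_two_lt_arctan v
  have hcu := (Real.cos_arctan_pos u).ne'
  have hcv := (Real.cos_arctan_pos v).ne'
  have htan : Real.tan (Real.pi / 2 - (Real.arctan u - Real.arctan v))
      = (1 + u * v) / (u - v) := by
    have hsu : Real.sin (Real.arctan u) = u * Real.cos (Real.arctan u) := by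
      rw [← Real.tan_mul_cos hcu, Real.tan_arctan]
    have hsv : Real.sin (Real.arctan v) = v * Real.cos (Real.arctan v) := by
      rw [← Real.tan_mul_cos hcv, Real.tan_arctan]
    rw [Real.tan_eq_sin_div_cos, Real.sin_pi_div_two_sub, Real.cos_pi_div_two_sub, Real.cos_sub,
      Real.sin_sub, hsu, hsv]
    have huv' : u - v ≠ 0 := sub_ne_zero.2 huv.ne'
    rw [show u * Real.cos (Real.arctan u) * Real.cos (Real.arctan v)
        - Real.cos (Real.arctan u) * (v * Real.cos (Real.arctan v))
        = (u - v) * (Real.cos (Real.arctan u) * Real.cos (Real.arctan v)) by ring,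
      show Real.cos (Real.arctan u) * Real.cos (Real.arctan v)
        + u * Real.cos (Real.arctan u) * (v * Real.cos (Real.arctan v))
        = (1 + u * v) * (Real.cos (Real.arctan u) * Real.cos (Real.arctan v)) by ring,
      mul_div_mul_right _ _ (mul_ne_zero hcu hcv)]
  rw [← htan, Real.arctan_tan (by linarith) (by linarith)]
  ring

/-- The angle relation behind the substitution `t ↦ 1 / t` in `∫ dt / (a + b t + c t²)`. -/
theorem arctan_add_arctan_eq {a b c s : ℝ} (ha : 0 < a) (hs : 0 < s)
    (h : s ^ 2 = 4 * a * c - b ^ 2) :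
    Real.arctan ((2 * c + b) / s) + Real.arctan ((2 * a + b) / s)
      = Real.pi / 2 + Real.arctan (b / s) := by
  have hlt : b / s < (2 * a + b) / s := by gcongr; linarith
  have := arctan_sub_arctan hlt
  rw [show (1 + (2 * a + b) / s * (b / s)) / ((2 * a + b) / s - b / s) = (2 * c + b) / s by
    rw [div_eq_div_iff (sub_ne_zero.2 hlt.ne') hs.ne']
    field_simp
    linear_combination h] at this
  linarith

theorem quadForm_pos {a b c s : ℝ} (hc : 0 < c) (hs : 0 < s) (h : s ^ 2 = 4 * a * c - b ^ 2)
    {x : ℝ} (hx : 0 < x) (y : ℝ) : 0 < a * x ^ 2 + b * x * y + c * y ^ 2 := by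
  have : 4 * c * (a * x ^ 2 + b * x * y + c * y ^ 2) = (2 * c * y + b * x) ^ 2 + s ^ 2 * x ^ 2 := by
    linear_combination (-x ^ 2) * h
  have h2 : 0 < 4 * c * (a * x ^ 2 + b * x * y + c * y ^ 2) := by rw [this]; positivity
  exact pos_of_mul_pos_right h2 (by positivity)

theorem hasDerivAt_arctan_quadForm {a b c s : ℝ} (hc : 0 < c) (hs : 0 < s)
    (h : s ^ 2 = 4 * a * c - b ^ 2) {x : ℝ} (hx : 0 < x) (y : ℝ) :
    HasDerivAt (fun y => 2 / (s * x) * Real.arctan ((2 * c * y + b * x) / (s * x)))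
      (1 / (a * x ^ 2 + b * x * y + c * y ^ 2)) y := by
  have hQ := quadForm_pos hc hs h hx y
  have h1 : HasDerivAt (fun y => (2 * c * y + b * x) / (s * x)) (2 * c / (s * x)) y := by
    simpa using (((hasDerivAt_id y).const_mul (2 * c)).add_const (b * x)).div_const (s * x)
  refine (h1.arctan.const_mul (2 / (s * x))).congr_deriv ?_
  have h2 : 1 + ((2 * c * y + b * x) / (s * x)) ^ 2
      = 4 * c * (a * x ^ 2 + b * x * y + c * y ^ 2) / (s * x) ^ 2 := by
    rw [eq_div_iff (by positivity)]
    field_simp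
    linear_combination x ^ 2 * h
  rw [h2]
  field_simp
  ring

theorem contDiff_hasDerivAt_iteratedDeriv {f : ℝ → ℝ} (hf : ContDiff ℝ (⊤ : ℕ∞) f) (i : ℕ) (x : ℝ) :
    HasDerivAt (iteratedDeriv i f) (iteratedDeriv (i + 1) f x) x := by
  rw [iteratedDeriv_succ]
  exact (hf.differentiable_iteratedDeriv i (by exact_mod_cast ENat.natCast_lt_top i) x).hasDerivAt

/-- By homogeneity the row is `n⁻²` times a sum of values of `1/(a + by + cy²)` at `y = k/n`. In the
corrected trapezoidal rule the integral is an arctangent difference, the endpoint values give the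
`n⁻²` term and the endpoint derivatives the `n⁻³` term. -/
theorem exists_abs_row_sum_sub_le {a b c s : ℝ} (hc : 0 < c) (hs : 0 < s)
    (h : s ^ 2 = 4 * a * c - b ^ 2) :
    ∃ M : ℝ, ∀ n : ℕ, 1 ≤ n →
      |∑ k ∈ Finset.Ico 1 n, 1 / (a * (n : ℝ) ^ 2 + b * n * k + c * (k : ℝ) ^ 2)
        - (2 / s * (Real.arctan ((2 * c + b) / s) - Real.arctan (b / s)) / n
          - (1 / a + 1 / (a + b + c)) / (2 * (n : ℝ) ^ 2)
          + (b / a ^ 2 - (b + 2 * c) / (a + b + c) ^ 2) / (12 * (n : ℝ) ^ 3))|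
        ≤ M / (n : ℝ) ^ 5 := by
  set f : ℝ → ℝ := fun y => 2 / s * Real.arctan ((2 * c * y + b) / s) with hf
  have hQ : ∀ y : ℝ, 0 < a + b * y + c * y ^ 2 := fun y => by
    simpa using quadForm_pos hc hs h one_pos y
  have hcd : ContDiff ℝ (⊤ : ℕ∞) f :=
    contDiff_const.mul (Real.contDiff_arctan.comp
      (((contDiff_const.mul contDiff_id).add contDiff_const).div_const s))
  have h1 : iteratedDeriv 1 f = fun y => 1 / (a + b * y + c * y ^ 2) := by
    rw [iteratedDeriv_one]
    funext y
    have := (hasDerivAt_arctan_quadForm hc hs h one_pos y).deriv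
    simp only [mul_one, one_pow] at this
    exact this
  have h2 : iteratedDeriv 2 f = fun y => -(b + 2 * c * y) / (a + b * y + c * y ^ 2) ^ 2 := by
    rw [iteratedDeriv_succ, h1]
    funext y
    have : HasDerivAt (fun y => a + b * y + c * y ^ 2) (b + 2 * c * y) y := by
      refine ((((hasDerivAt_id y).const_mul b).const_add a).add
        ((hasDerivAt_pow 2 y).const_mul c)).congr_deriv ?_
      norm_num; ring
    simpa using (this.fun_inv (hQ y).ne').deriv
  obtain ⟨M, hM⟩ := exists_abs_corrected_trapezoid_le (contDiff_hasDerivAt_iteratedDeriv hcd)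
  refine ⟨M, fun n hn => ?_⟩
  have hn0 : (0 : ℝ) < n := by exact_mod_cast hn
  have hrow : ∑ k ∈ Finset.Ico 1 n, 1 / (a * (n : ℝ) ^ 2 + b * n * k + c * (k : ℝ) ^ 2)
      = 1 / (n : ℝ) ^ 2 * ∑ k ∈ Finset.Ico 1 n, 1 / (a + b * (k / n) + c * ((k : ℝ) / n) ^ 2) := by
    rw [Finset.mul_sum]
    refine Finset.sum_congr rfl fun k _ => ?_
    rw [one_div_mul_one_div]
    congr 1
    field_simp
  have key := hM n hn
  rw [h1, h2] at key
  simp only [iteratedDeriv_zero, hf] at key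
  rw [hrow]
  calc _ = 1 / (n : ℝ) * |2 / s * Real.arctan ((2 * c * 1 + b) / s)
          - 2 / s * Real.arctan ((2 * c * 0 + b) / s)
          - 1 / n * (∑ k ∈ Finset.Ico 1 n, 1 / (a + b * (k / n) + c * ((k : ℝ) / n) ^ 2)
            + (1 / (a + b * 0 + c * 0 ^ 2) + 1 / (a + b * 1 + c * 1 ^ 2)) / 2)
          + (-(b + 2 * c * 1) / (a + b * 1 + c * 1 ^ 2) ^ 2
            - -(b + 2 * c * 0) / (a + b * 0 + c * 0 ^ 2) ^ 2) / (12 * (n : ℝ) ^ 2)| := by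
        rw [← abs_of_pos (by positivity : (0 : ℝ) < 1 / n), ← abs_mul,
          abs_of_pos (by positivity : (0 : ℝ) < 1 / n), ← abs_neg]
        congr 1
        simp only [mul_zero, mul_one, zero_add, add_zero, one_pow, ne_eq, OfNat.ofNat_ne_zero,
          not_false_eq_true, zero_pow]
        ring
    _ ≤ 1 / (n : ℝ) * (M / (n : ℝ) ^ 4) := by gcongr
    _ = M / (n : ℝ) ^ 5 := by ring

/-- The edge with `k = n` is written with `a` and `c` exchanged, so that a single row estimate
serves all four edge sums. -/
theorem G_succ_sub (a b c : ℝ) {n : ℕ} (hn : 1 ≤ n) :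
    G a b c (n + 1) - G a b c n =
      ∑ k ∈ Finset.Ico 1 n, 1 / (a * (n : ℝ) ^ 2 + b * n * k + c * (k : ℝ) ^ 2)
      + ∑ k ∈ Finset.Ico 1 n, 1 / (a * (n : ℝ) ^ 2 + (-b) * n * k + c * (k : ℝ) ^ 2)
      + ∑ k ∈ Finset.Ico 1 n, 1 / (c * (n : ℝ) ^ 2 + b * n * k + a * (k : ℝ) ^ 2)
      + ∑ k ∈ Finset.Ico 1 n, 1 / (c * (n : ℝ) ^ 2 + (-b) * n * k + a * (k : ℝ) ^ 2)
      + (1 / (a - b + c) + 1 / (a + b + c)) / (n : ℝ) ^ 2 := by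
  unfold G
  rw [Finset.sum_Ico_succ_top hn]
  simp_rw [Finset.sum_Ico_succ_top hn, Finset.sum_add_distrib]
  have e1 : ∀ k : ℕ, a * (n : ℝ) ^ 2 + (-b) * n * k + c * (k : ℝ) ^ 2
      = a * (n : ℝ) ^ 2 - b * n * k + c * (k : ℝ) ^ 2 := fun k => by ring
  have e2 : ∀ k : ℕ, c * (n : ℝ) ^ 2 + b * n * k + a * (k : ℝ) ^ 2
      = a * (k : ℝ) ^ 2 + b * k * n + c * (n : ℝ) ^ 2 := fun k => by ring
  have e3 : ∀ k : ℕ, c * (n : ℝ) ^ 2 + (-b) * n * k + a * (k : ℝ) ^ 2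
      = a * (k : ℝ) ^ 2 - b * k * n + c * (n : ℝ) ^ 2 := fun k => by ring
  have e4 : a * (n : ℝ) ^ 2 - b * n * n + c * (n : ℝ) ^ 2 = (a - b + c) * (n : ℝ) ^ 2 := by ring
  have e5 : a * (n : ℝ) ^ 2 + b * n * n + c * (n : ℝ) ^ 2 = (a + b + c) * (n : ℝ) ^ 2 := by ring
  simp only [e1, e2, e3, e4, e5]
  rw [add_div, div_div, div_div]
  ring

/-! ### Increments of the remainder -/

theorem isBigO_log_succ_sub :
    (fun n : ℕ => Real.log ((n + 1 : ℕ) : ℝ) - Real.log n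
      - (1 / (n : ℝ) - 1 / (2 * (n : ℝ) ^ 2) + 1 / (3 * (n : ℝ) ^ 3) - 1 / (4 * (n : ℝ) ^ 4)))
      =O[atTop] fun n : ℕ => 1 / (n : ℝ) ^ 5 := by
  refine Asymptotics.IsBigO.of_bound 2 ?_
  filter_upwards [eventually_ge_atTop 2] with n hn
  have hn2 : (2 : ℝ) ≤ n := by exact_mod_cast hn
  have hn0 : (0 : ℝ) < n := by linarith
  have habs : |-(1 / (n : ℝ))| = 1 / n := by rw [abs_neg, abs_of_pos (by positivity)]
  have hle : 1 / (n : ℝ) ≤ 1 / 2 := one_div_le_one_div_of_le two_pos hn2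
  have key := Real.abs_log_sub_add_sum_range_le (x := -(1 / (n : ℝ))) (by rw [habs]; linarith) 4
  rw [habs] at key
  have hlog : Real.log (1 - -(1 / (n : ℝ))) = Real.log ((n + 1 : ℕ) : ℝ) - Real.log n := by
    rw [← Real.log_div (by positivity) hn0.ne']
    congr 1
    push_cast
    field_simp
    ring
  rw [hlog] at key
  simp only [Finset.sum_range_succ, Finset.sum_range_zero] at key
  rw [Real.norm_eq_abs, Real.norm_of_nonneg (by positivity)]
  refine le_of_eq_of_le (congrArg abs ?_) (key.trans ?_)
  · push_cast; ring
  -- For `n ≥ 2` the denominator `1 - 1/n` of the Taylor remainder is at least `1/2`, whence the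
  -- constant `2`.
  · rw [div_le_iff₀ (by linarith), one_div_pow]
    have : 0 ≤ 1 / (n : ℝ) ^ 5 := by positivity
    nlinarith

theorem isBigO_inv_succ_sub :
    (fun n : ℕ => 1 / ((n + 1 : ℕ) : ℝ) - (1 / (n : ℝ) - 1 / (n : ℝ) ^ 2 + 1 / (n : ℝ) ^ 3
      - 1 / (n : ℝ) ^ 4)) =O[atTop] fun n : ℕ => 1 / (n : ℝ) ^ 5 := by
  refine Asymptotics.IsBigO.of_bound 1 ?_
  filter_upwards [eventually_ge_atTop 1] with n hn
  have hn0 : (0 : ℝ) < n := by exact_mod_cast hn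
  have e : 1 / ((n + 1 : ℕ) : ℝ) - (1 / (n : ℝ) - 1 / (n : ℝ) ^ 2 + 1 / (n : ℝ) ^ 3
      - 1 / (n : ℝ) ^ 4) = (n / (n + 1)) * (1 / (n : ℝ) ^ 5) := by
    push_cast
    field_simp
    ring
  rw [e, norm_mul]
  gcongr
  rw [Real.norm_of_nonneg (by positivity)]
  exact div_le_one_of_le₀ (by linarith) (by positivity)

theorem isBigO_inv_succ_sq_sub :
    (fun n : ℕ => 1 / ((n + 1 : ℕ) : ℝ) ^ 2 - (1 / (n : ℝ) ^ 2 - 2 / (n : ℝ) ^ 3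
      + 3 / (n : ℝ) ^ 4)) =O[atTop] fun n : ℕ => 1 / (n : ℝ) ^ 5 := by
  refine Asymptotics.IsBigO.of_bound 7 ?_
  filter_upwards [eventually_ge_atTop 1] with n hn
  have hn0 : (0 : ℝ) < n := by exact_mod_cast hn
  have e : 1 / ((n + 1 : ℕ) : ℝ) ^ 2 - (1 / (n : ℝ) ^ 2 - 2 / (n : ℝ) ^ 3
      + 3 / (n : ℝ) ^ 4) = -(((4 * n + 3) * n) / (n + 1) ^ 2) * (1 / (n : ℝ) ^ 5) := by
    push_cast
    field_simp
    ring
  rw [e, norm_mul]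
  gcongr
  rw [norm_neg, Real.norm_of_nonneg (by positivity), div_le_iff₀ (by positivity)]
  nlinarith

theorem isBigO_inv_succ_cube_sub :
    (fun n : ℕ => 1 / ((n + 1 : ℕ) : ℝ) ^ 3 - (1 / (n : ℝ) ^ 3 - 3 / (n : ℝ) ^ 4))
      =O[atTop] fun n : ℕ => 1 / (n : ℝ) ^ 5 := by
  refine Asymptotics.IsBigO.of_bound 17 ?_
  filter_upwards [eventually_ge_atTop 1] with n hn
  have hn0 : (0 : ℝ) < n := by exact_mod_cast hn
  -- The remainder is an exact rational multiple of `n⁻⁵`, and `17 = 6 + 8 + 3` bounds the factor.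
  have e : 1 / ((n + 1 : ℕ) : ℝ) ^ 3 - (1 / (n : ℝ) ^ 3 - 3 / (n : ℝ) ^ 4)
      = ((6 * (n : ℝ) ^ 2 + 8 * n + 3) * n / (n + 1) ^ 3) * (1 / (n : ℝ) ^ 5) := by
    push_cast
    field_simp
    ring
  rw [e, norm_mul]
  gcongr
  rw [Real.norm_of_nonneg (by positivity), div_le_iff₀ (by positivity)]
  have : 0 < (n : ℝ) ^ 3 := by positivity
  nlinarith [sq_nonneg (n : ℝ)]

theorem isBigO_row_sum_sub {a b c s : ℝ} (hc : 0 < c) (hs : 0 < s)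
    (h : s ^ 2 = 4 * a * c - b ^ 2) :
    (fun n : ℕ => ∑ k ∈ Finset.Ico 1 n, 1 / (a * (n : ℝ) ^ 2 + b * n * k + c * (k : ℝ) ^ 2)
        - (2 / s * (Real.arctan ((2 * c + b) / s) - Real.arctan (b / s)) / n
          - (1 / a + 1 / (a + b + c)) / (2 * (n : ℝ) ^ 2)
          + (b / a ^ 2 - (b + 2 * c) / (a + b + c) ^ 2) / (12 * (n : ℝ) ^ 3)))
      =O[atTop] fun n : ℕ => 1 / (n : ℝ) ^ 5 := by
  obtain ⟨M, hM⟩ := exists_abs_row_sum_sub_le hc hs h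
  refine Asymptotics.IsBigO.of_bound M ?_
  filter_upwards [eventually_ge_atTop 1] with n hn
  rw [Real.norm_eq_abs, Real.norm_of_nonneg (by positivity), mul_one_div]
  exact hM n hn

/-- Each edge pairs with its transpose through `arctan_add_arctan_eq`, and the terms `arctan(±b/s)`
cancel, leaving `2π/s`. In order `n⁻²` the far endpoint values cancel the corner term. In order
`n⁻³` the terms `±b/a²`, `±b/c²` cancel, and the far derivatives combine to `-2/(a ± b + c)`. -/
theorem isBigO_G_succ_sub {a b c s : ℝ} (ha : 0 < a) (hc : 0 < c) (hs : 0 < s)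
    (h : s ^ 2 = 4 * a * c - b ^ 2) :
    (fun n : ℕ => G a b c (n + 1) - G a b c n
        - (2 * Real.pi / s / n - (1 / a + 1 / c) / (n : ℝ) ^ 2
          - (1 / (a - b + c) + 1 / (a + b + c)) / (6 * (n : ℝ) ^ 3)))
      =O[atTop] fun n : ℕ => 1 / (n : ℝ) ^ 5 := by
  have h' : s ^ 2 = 4 * a * c - (-b) ^ 2 := by linear_combination h
  have h1 := isBigO_row_sum_sub hc hs h
  have h2 := isBigO_row_sum_sub hc hs h'
  have h3 := isBigO_row_sum_sub (a := c) (b := b) (c := a) ha hs (by linear_combination h)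
  have h4 := isBigO_row_sum_sub (a := c) (b := -b) (c := a) ha hs (by linear_combination h)
  refine (((h1.add h2).add h3).add h4).congr' ?_ EventuallyEq.rfl
  filter_upwards [eventually_ge_atTop 1] with n hn
  have hp : 0 < a + b + c := by simpa using quadForm_pos hc hs h one_pos 1
  have hm : 0 < a - b + c := by
    have := quadForm_pos hc hs h' one_pos 1
    simp only [one_pow, mul_one] at this
    linarith
  have hn0 : (0 : ℝ) < n := by exact_mod_cast hn
  have A1 := arctan_add_arctan_eq ha hs h
  have A2 := arctan_add_arctan_eq ha hs h'
  have hA : 2 / s * (Real.arctan ((2 * c + b) / s) - Real.arctan (b / s))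
      + 2 / s * (Real.arctan ((2 * c + -b) / s) - Real.arctan (-b / s))
      + 2 / s * (Real.arctan ((2 * a + b) / s) - Real.arctan (b / s))
      + 2 / s * (Real.arctan ((2 * a + -b) / s) - Real.arctan (-b / s)) = 2 * Real.pi / s := by
    rw [neg_div, Real.arctan_neg] at *
    linear_combination (2 / s) * (A1 + A2)
  have hB1 : -(b + 2 * c) / (a + b + c) ^ 2 - (b + 2 * a) / (c + b + a) ^ 2
      = -2 / (a + b + c) := by
    rw [show c + b + a = a + b + c by ring]
    field_simp
    ring
  have hB2 : -(-b + 2 * c) / (a + -b + c) ^ 2 - (-b + 2 * a) / (c + -b + a) ^ 2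
      = -2 / (a - b + c) := by
    rw [show c + -b + a = a - b + c by ring, show a + -b + c = a - b + c by ring]
    field_simp
    ring
  rw [G_succ_sub a b c hn, ← hA]
  rw [show c + b + a = a + b + c by ring] at *
  rw [show c + -b + a = a - b + c by ring, show a + -b + c = a - b + c by ring] at *
  linear_combination (-1 / (12 * (n : ℝ) ^ 3)) * (hB1 + hB2)

/-- The part of the expansion that does not involve the constant term has the same increments as
`G` up to `O(n⁻⁵)`. -/
theorem isBigO_increment {a b c s : ℝ} (ha : 0 < a) (hc : 0 < c) (hs : 0 < s)
    (h : s ^ 2 = 4 * a * c - b ^ 2) (hsd : Real.sqrt |disc a b c| = s) :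
    (fun n : ℕ =>
      (G a b c (n + 1) - (2 * Real.pi / s * Real.log ((n + 1 : ℕ) : ℝ)
        + coeff1 a b c * (1 / ((n + 1 : ℕ) : ℝ)) + coeff2 a b c * (1 / ((n + 1 : ℕ) : ℝ) ^ 2)
        + coeff3 a b c * (1 / ((n + 1 : ℕ) : ℝ) ^ 3)))
      - (G a b c n - (2 * Real.pi / s * Real.log (n : ℝ)
        + coeff1 a b c * (1 / (n : ℝ)) + coeff2 a b c * (1 / (n : ℝ) ^ 2)
        + coeff3 a b c * (1 / (n : ℝ) ^ 3))))
      =O[atTop] fun n : ℕ => 1 / (n : ℝ) ^ 5 := by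
  -- Orders `n⁻²`, `n⁻³`, `n⁻⁴` form a triangular system whose solution is `coeff1`, `coeff2`,
  -- `coeff3`, so everything below `n⁻⁵` cancels.
  refine ((((isBigO_G_succ_sub ha hc hs h).sub
    (isBigO_log_succ_sub.const_mul_left (2 * Real.pi / s))).sub
    (isBigO_inv_succ_sub.const_mul_left (coeff1 a b c))).sub
    (isBigO_inv_succ_sq_sub.const_mul_left (coeff2 a b c))).sub
    (isBigO_inv_succ_cube_sub.const_mul_left (coeff3 a b c)) |>.congr_left fun n => ?_
  simp only [coeff1, coeff2, coeff3, hsd]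
  ring

/-! ### The logarithmic integral in terms of Clausen functions -/

/-- The antiderivative of `s / 2 * (1 / (a x² - b x + c) + 1 / (a x² + b x + c))` vanishing at
`0`, where `s² = 4 a c - b²`. -/
noncomputable def angleSum (a b s x : ℝ) : ℝ :=
  Real.arctan ((2 * a * x + b) / s) + Real.arctan ((2 * a * x - b) / s)

theorem angleSum_zero (a b s : ℝ) : angleSum a b s 0 = 0 := by
  simp [angleSum, neg_div, Real.arctan_neg]

theorem hasDerivAt_arctan_linear (a b s x : ℝ) :
    HasDerivAt (fun x => Real.arctan ((2 * a * x + b) / s))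
      (1 / (1 + ((2 * a * x + b) / s) ^ 2) * (2 * a / s)) x := by
  have h1 : HasDerivAt (fun y => (2 * a * y + b) / s) (2 * a / s) x := by
    simpa using (((hasDerivAt_id x).const_mul (2 * a)).add_const b).div_const s
  exact h1.arctan

theorem differentiable_angleSum (a b s : ℝ) : Differentiable ℝ (angleSum a b s) := fun x =>
  ((hasDerivAt_arctan_linear a b s x).add
    (by simpa only [sub_eq_add_neg] using hasDerivAt_arctan_linear a (-b) s x)).differentiableAt

/-- The continuous extension of `x ↦ angleSum a b s x / x` to `x = 0`. -/
noncomputable def angleSlope (a b s : ℝ) : ℝ → ℝ := dslope (angleSum a b s) 0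

theorem continuous_angleSlope (a b s : ℝ) : Continuous (angleSlope a b s) := by
  rw [← continuousOn_univ, angleSlope, continuousOn_dslope univ_mem]
  exact ⟨(differentiable_angleSum a b s).continuous.continuousOn, differentiable_angleSum a b s 0⟩

theorem mul_angleSlope (a b s x : ℝ) : x * angleSlope a b s x = angleSum a b s x := by
  simpa [angleSlope, angleSum_zero] using sub_smul_dslope (angleSum a b s) 0 x

theorem angleSlope_of_ne {a b s x : ℝ} (hx : x ≠ 0) :
    angleSlope a b s x = angleSum a b s x / x := by
  rw [← mul_angleSlope, mul_div_cancel_left₀ _ hx]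

/-- One half of the Clausen part of the primitive of `2 * angleSum a b s x / x`. -/
noncomputable def clausenPair (a b s x : ℝ) : ℝ :=
  clausen (Real.pi - 2 * Real.arctan ((2 * a * x + b) / s))
    + clausen (2 * Real.arctan ((2 * a * x + b) / s) - 2 * Real.arctan (b / s))

theorem continuous_clausenPair (a b s : ℝ) : Continuous (clausenPair a b s) := by
  have h1 : Continuous fun x : ℝ => Real.arctan ((2 * a * x + b) / s) :=
    Real.continuous_arctan.comp (by fun_prop)
  exact (continuous_clausen.comp (by fun_prop)).add (continuous_clausen.comp (by fun_prop))

/-- The factor `cos (arctan u)` is kept because it cancels against the derivative of the other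
Clausen term. -/
theorem sin_arctan_sub_arctan (u v : ℝ) :
    Real.sin (Real.arctan u - Real.arctan v)
      = (u - v) * Real.cos (Real.arctan u) / Real.sqrt (1 + v ^ 2) := by
  have hsu : Real.sin (Real.arctan u) = u * Real.cos (Real.arctan u) := by
    rw [← Real.tan_mul_cos (Real.cos_arctan_pos u).ne', Real.tan_arctan]
  rw [Real.sin_sub, hsu, Real.sin_arctan v, Real.cos_arctan v]
  ring

/-- The two Clausen derivatives involve `log (2 cos α)` and `log (2 cos α · x √(a/c))` with `α =
arctan u`. They enter with opposite signs, so only `log (x √(a/c))` survives. -/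
theorem hasDerivAt_clausenPair {a b c s x : ℝ} (ha : 0 < a) (hc : 0 < c) (hs : 0 < s)
    (h : s ^ 2 = 4 * a * c - b ^ 2) (hx : 0 < x) :
    HasDerivAt (clausenPair a b s)
      (1 / (1 + ((2 * a * x + b) / s) ^ 2) * (2 * a / s) * (Real.log (c / a) - 2 * Real.log x))
      x := by
  set u := (2 * a * x + b) / s with hu
  set v := b / s with hv
  have hax : 0 < a * x := by positivity
  have huv : v < u := by rw [hu, hv]; gcongr; linarith
  have hlt := Real.arctan_strictMono huv
  have hu1 := Real.arctan_lt_pi_div_two u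
  have hu2 := Real.neg_pi_div_two_lt_arctan u
  have hv2 := Real.neg_pi_div_two_lt_arctan v
  have hd := hasDerivAt_arctan_linear a b s x
  have hcos := Real.cos_arctan_pos u
  have d1 := HasDerivAt.comp x (hasDerivAt_clausen (θ := Real.pi - 2 * Real.arctan u)
    (by linarith) (by linarith)) ((hd.const_mul 2).const_sub Real.pi)
  have d2 := HasDerivAt.comp x (hasDerivAt_clausen (θ := 2 * Real.arctan u - 2 * Real.arctan v)
    (by linarith) (by linarith)) ((hd.const_mul 2).sub_const (2 * Real.arctan v))
  refine (d1.add d2).congr_deriv ?_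
  rw [show (Real.pi - 2 * Real.arctan u) / 2 = Real.pi / 2 - Real.arctan u by ring,
    show (2 * Real.arctan u - 2 * Real.arctan v) / 2 = Real.arctan u - Real.arctan v by ring,
    Real.sin_pi_div_two_sub, sin_arctan_sub_arctan]
  have hsq : (u - v) / Real.sqrt (1 + v ^ 2) = x * Real.sqrt (a / c) := by
    have h1 : 1 + v ^ 2 = (2 * a / s) ^ 2 * (c / a) := by
      rw [hv]
      field_simp
      linear_combination h
    rw [h1, Real.sqrt_mul (by positivity), Real.sqrt_sq (by positivity),
      ← inv_div c a, Real.sqrt_inv, hu, hv]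
    have : 0 < Real.sqrt (c / a) := Real.sqrt_pos.2 (by positivity)
    field_simp
    ring
  have hlog : Real.log (2 * ((u - v) * Real.cos (Real.arctan u) / Real.sqrt (1 + v ^ 2)))
      = Real.log (2 * Real.cos (Real.arctan u)) + Real.log x - Real.log (c / a) / 2 := by
    rw [show 2 * ((u - v) * Real.cos (Real.arctan u) / Real.sqrt (1 + v ^ 2))
      = 2 * Real.cos (Real.arctan u) * ((u - v) / Real.sqrt (1 + v ^ 2)) by ring, hsq,
      Real.log_mul (by positivity) (by positivity), Real.log_mul hx.ne' (by positivity),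
      Real.log_sqrt (by positivity), ← inv_div c a, Real.log_inv]
    ring
  rw [hlog, ← hu]
  ring

/-- A primitive of `2 * angleSum a b s x / x`. -/
noncomputable def clausenPrimitive (a b c s x : ℝ) : ℝ :=
  clausenPair a b s x + clausenPair a (-b) s x
    - angleSum a b s x * Real.log (c / a) + 2 * (angleSlope a b s x * (x * Real.log x))

/-- Continuity at `0` is the reason for writing `angleSum · log x` as `angleSlope · (x log x)`. -/
theorem continuous_clausenPrimitive (a b c s : ℝ) : Continuous (clausenPrimitive a b c s) :=
  (((continuous_clausenPair a b s).add (continuous_clausenPair a (-b) s)).sub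
    ((differentiable_angleSum a b s).continuous.mul continuous_const)).add
    (continuous_const.mul ((continuous_angleSlope a b s).mul Real.continuous_mul_log))

/-- Integration by parts: in the derivative of `2 · angleSum · log x`, the part containing `log x`
is cancelled by the Clausen pairs, and `2 · angleSum / x` remains. -/
theorem hasDerivAt_clausenPrimitive {a b c s x : ℝ} (ha : 0 < a) (hc : 0 < c) (hs : 0 < s)
    (h : s ^ 2 = 4 * a * c - b ^ 2) (hx : 0 < x) :
    HasDerivAt (clausenPrimitive a b c s) (2 * angleSlope a b s x) x := by
  have h' : s ^ 2 = 4 * a * c - (-b) ^ 2 := by linear_combination h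
  have hα : HasDerivAt (angleSum a b s) (1 / (1 + ((2 * a * x + b) / s) ^ 2) * (2 * a / s)
      + 1 / (1 + ((2 * a * x + -b) / s) ^ 2) * (2 * a / s)) x :=
    (hasDerivAt_arctan_linear a b s x).add
      (by simpa only [sub_eq_add_neg] using hasDerivAt_arctan_linear a (-b) s x)
  have hE : clausenPrimitive a b c s = fun x => clausenPair a b s x + clausenPair a (-b) s x
      - angleSum a b s x * Real.log (c / a) + 2 * (angleSum a b s x * Real.log x) := by
    funext y
    rw [clausenPrimitive, ← mul_angleSlope a b s y]
    ring
  rw [hE]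
  refine ((((hasDerivAt_clausenPair ha hc hs h hx).add (hasDerivAt_clausenPair ha hc hs h' hx)).sub
    (hα.mul_const _)).add ((hα.mul (Real.hasDerivAt_log hx.ne')).const_mul 2)).congr_deriv ?_
  rw [angleSlope_of_ne hx.ne']
  ring

theorem clausenPrimitive_zero (a b c s : ℝ) : clausenPrimitive a b c s 0 = 0 := by
  have := clausen_pi_sub_add_clausen_pi_add (2 * Real.arctan (b / s))
  simp only [clausenPrimitive, clausenPair, angleSum_zero, mul_zero, zero_add, sub_self,
    clausen_zero, neg_div, Real.arctan_neg, mul_neg, sub_neg_eq_add, zero_mul, add_zero, this]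

theorem clausenPrimitive_one {a b c s : ℝ} (ha : 0 < a) (hs : 0 < s)
    (h : s ^ 2 = 4 * a * c - b ^ 2) (hsd : Real.sqrt |disc a b c| = s) :
    clausenPrimitive a b c s 1 = clausenSum a b c
      - (Real.pi / 2 - Real.arctan ((c - a) / s)) * Real.log (c / a) := by
  have h' : s ^ 2 = 4 * a * c - (-b) ^ 2 := by linear_combination h
  have hα : angleSum a b s 1 = Real.pi / 2 - Real.arctan ((c - a) / s) := by
    have hlt : (b - 2 * a) / s < (2 * a + b) / s := by gcongr; linarith
    have e := arctan_sub_arctan hlt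
    rw [show (1 + (2 * a + b) / s * ((b - 2 * a) / s)) / ((2 * a + b) / s - (b - 2 * a) / s)
        = (c - a) / s by
      rw [div_eq_div_iff (sub_ne_zero.2 hlt.ne') hs.ne']
      field_simp
      linear_combination h] at e
    rw [← e, angleSum, show (2 * a * 1 - b) / s = -((b - 2 * a) / s) by ring, Real.arctan_neg,
      mul_one]
    ring
  have e1 := arctan_add_arctan_eq ha hs h
  have e2 := arctan_add_arctan_eq ha hs h'
  -- The angle relation turns the second Clausen argument of each pair into one with `a` replaced by
  -- `c`, which produces the four terms of `clausenSum`.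
  have p1 : 2 * Real.arctan ((2 * a + b) / s) - 2 * Real.arctan (b / s)
      = Real.pi - 2 * Real.arctan ((2 * c + b) / s) := by linarith
  have p2 : 2 * Real.arctan ((2 * a + -b) / s) - 2 * Real.arctan (-b / s)
      = Real.pi - 2 * Real.arctan ((2 * c + -b) / s) := by linarith
  rw [clausenPrimitive, hα, clausenPair, clausenPair, mul_one, p1, p2, clausenSum, hsd,
    Real.log_one]
  simp only [← sub_eq_add_neg]
  ring

theorem tendsto_sum_angleSlope {a b c s : ℝ} (ha : 0 < a) (hc : 0 < c) (hs : 0 < s)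
    (h : s ^ 2 = 4 * a * c - b ^ 2) (hsd : Real.sqrt |disc a b c| = s) :
    Tendsto (fun n : ℕ => 1 / (n : ℝ) * ∑ j ∈ Finset.Ico 1 n, 2 * angleSlope a b s (j / n)) atTop
      (𝓝 (clausenSum a b c - (Real.pi / 2 - Real.arctan ((c - a) / s)) * Real.log (c / a))) := by
  have hcont : Continuous fun x => 2 * angleSlope a b s x :=
    continuous_const.mul (continuous_angleSlope a b s)
  have key := tendsto_riemann_sum (continuous_clausenPrimitive a b c s).continuousOn
    hcont.continuousOn (fun x hx => hasDerivAt_clausenPrimitive ha hc hs h hx.1)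
  rw [clausenPrimitive_zero, clausenPrimitive_one ha hs h hsd, sub_zero] at key
  have h0 : Tendsto (fun n : ℕ => 1 / (n : ℝ) * (2 * angleSlope a b s 0)) atTop (𝓝 0) := by
    simpa using tendsto_one_div_atTop_nhds_zero_nat.mul_const (2 * angleSlope a b s 0)
  have := key.sub h0
  rw [sub_zero] at this
  refine this.congr' ?_
  filter_upwards [eventually_ge_atTop 1] with n hn
  rw [Finset.range_eq_Ico, Finset.sum_eq_sum_Ico_succ_bot (by omega)]
  simp only [Nat.cast_zero, zero_div]
  ring

/-! ### Tails of the column sums -/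

theorem le_quadForm {a b c s : ℝ} (ha : 0 < a) (h : s ^ 2 = 4 * a * c - b ^ 2) (x y : ℝ) :
    s ^ 2 / (4 * a) * y ^ 2 ≤ a * x ^ 2 + b * x * y + c * y ^ 2 := by
  rw [div_mul_eq_mul_div, div_le_iff₀ (by positivity)]
  nlinarith [sq_nonneg (2 * a * x + b * y)]

/-- The increment of the primitive over `[k, k + 1]` is the integrand at some `ξ`. For `x ≤ k` the
difference of reciprocals has numerator `O(k)` and denominator at least a multiple of `k⁴`. The
constant does not depend on `x`, which later allows summation over all columns. -/
theorem exists_abs_inv_quadForm_sub_le {a b c s : ℝ} (ha : 0 < a) (hc : 0 < c) (hs : 0 < s)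
    (h : s ^ 2 = 4 * a * c - b ^ 2) :
    ∃ C : ℝ, 0 ≤ C ∧ ∀ x k : ℝ, 0 < x → x ≤ k → 1 ≤ k →
      |1 / (a * x ^ 2 + b * x * k + c * k ^ 2)
        - (2 / (s * x) * Real.arctan ((2 * c * (k + 1) + b * x) / (s * x))
          - 2 / (s * x) * Real.arctan ((2 * c * k + b * x) / (s * x)))| ≤ C / k ^ 3 := by
  refine ⟨(|b| + 3 * c) / (s ^ 2 / (4 * a)) ^ 2, by positivity, fun x k hx hxk hk => ?_⟩
  have hk0 : 0 < k := by linarith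
  obtain ⟨ξ, hξ, e⟩ := exists_hasDerivAt_eq_slope _ _ (lt_add_one k)
    (fun y _ => (hasDerivAt_arctan_quadForm hc hs h hx y).continuousAt.continuousWithinAt)
    (fun y _ => hasDerivAt_arctan_quadForm hc hs h hx y)
  rw [add_sub_cancel_left, div_one] at e
  rw [← e]
  have hQk := quadForm_pos hc hs h hx k
  have hQξ := quadForm_pos hc hs h hx ξ
  have lk := le_quadForm ha h x k
  have lξ : s ^ 2 / (4 * a) * k ^ 2 ≤ a * x ^ 2 + b * x * ξ + c * ξ ^ 2 :=
    le_trans (by gcongr; exact hξ.1.le) (le_quadForm ha h x ξ)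
  rw [div_sub_div _ _ hQk.ne' hQξ.ne', abs_div, abs_of_pos (mul_pos hQk hQξ),
    show 1 * (a * x ^ 2 + b * x * ξ + c * ξ ^ 2) - (a * x ^ 2 + b * x * k + c * k ^ 2) * 1
      = (ξ - k) * (b * x + c * (ξ + k)) by ring]
  have hnum : |(ξ - k) * (b * x + c * (ξ + k))| ≤ (|b| + 3 * c) * k := by
    rw [abs_mul, abs_of_pos (sub_pos.2 hξ.1)]
    have h1 : |b * x + c * (ξ + k)| ≤ (|b| + 3 * c) * k := by
      refine (abs_add_le _ _).trans ?_
      rw [abs_mul, abs_of_pos hx, abs_of_pos (mul_pos hc (by linarith [hξ.1]))]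
      have : |b| * x ≤ |b| * k := by gcongr
      have : c * (ξ + k) ≤ c * (3 * k) := by gcongr; linarith [hξ.2]
      linarith
    refine (mul_le_of_le_one_left (abs_nonneg _) (by linarith [hξ.2])).trans h1
  calc _ ≤ (|b| + 3 * c) * k / ((s ^ 2 / (4 * a) * k ^ 2) * (s ^ 2 / (4 * a) * k ^ 2)) := by
        gcongr
    _ = (|b| + 3 * c) / (s ^ 2 / (4 * a)) ^ 2 / k ^ 3 := by
        field_simp

theorem exists_abs_column_sum_sub_le {a b c s : ℝ} (ha : 0 < a) (hc : 0 < c) (hs : 0 < s)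
    (h : s ^ 2 = 4 * a * c - b ^ 2) :
    ∃ C : ℝ, ∀ n j : ℕ, 1 ≤ j → j < n → ∀ N, n ≤ N →
      |∑ k ∈ Finset.Ico n N, 1 / (a * (j : ℝ) ^ 2 + b * j * k + c * (k : ℝ) ^ 2)
        - (2 / (s * j) * Real.arctan ((2 * c * N + b * j) / (s * j))
          - 2 / (s * j) * Real.arctan ((2 * c * n + b * j) / (s * j)))| ≤ C / (n : ℝ) ^ 2 := by
  obtain ⟨C, hC0, hC⟩ := exists_abs_inv_quadForm_sub_le ha hc hs h
  refine ⟨2 * C, fun n j hj hjn N hN => ?_⟩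
  have hn1 : (1 : ℝ) ≤ n := by exact_mod_cast (by omega : 1 ≤ n)
  have hj0 : (0 : ℝ) < j := by exact_mod_cast hj
  -- The bound is strengthened to a telescoping one so that the induction on `N` closes.
  have aux : |∑ k ∈ Finset.Ico n N, 1 / (a * (j : ℝ) ^ 2 + b * j * k + c * (k : ℝ) ^ 2)
        - (2 / (s * j) * Real.arctan ((2 * c * N + b * j) / (s * j))
          - 2 / (s * j) * Real.arctan ((2 * c * n + b * j) / (s * j)))|
      ≤ 2 * C / n * (1 / n - 1 / N) := by
    induction N, hN using Nat.le_induction with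
    | base => simp
    | succ N hN ih =>
      have hNn : (n : ℝ) ≤ N := by exact_mod_cast hN
      have hN1 : (1 : ℝ) ≤ N := hn1.trans hNn
      have hjN : (j : ℝ) ≤ N := by exact_mod_cast (hjn.le.trans hN)
      have h1 := hC j N hj0 hjN hN1
      have h2 : C / (N : ℝ) ^ 3 ≤ 2 * C / n * (1 / N - 1 / (N + 1)) := by
        calc C / (N : ℝ) ^ 3 = C / N * (1 / (N : ℝ) ^ 2) := by field_simp
          _ ≤ C / n * (2 * (1 / N - 1 / (N + 1))) := by
            gcongr
            rw [div_sub_div _ _ (by positivity) (by positivity), mul_div_assoc',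
              div_le_div_iff₀ (by positivity) (by positivity)]
            nlinarith
          _ = _ := by ring
      rw [Finset.sum_Ico_succ_top hN]
      push_cast
      refine le_trans (le_of_eq (congrArg abs ?_)) ((abs_add_le _ _).trans
        ((add_le_add ih (h1.trans h2)).trans_eq ?_))
      · ring
      · ring
  refine aux.trans ?_
  have : (0 : ℝ) ≤ 1 / N := by positivity
  calc 2 * C / n * (1 / (n : ℝ) - 1 / N) ≤ 2 * C / n * (1 / n) := by gcongr; linarith
    _ = 2 * C / (n : ℝ) ^ 2 := by field_simp

theorem tendsto_arctan_linear (c b s : ℝ) (hc : 0 < c) (hs : 0 < s) :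
    Tendsto (fun N : ℕ => Real.arctan ((2 * c * N + b) / s)) atTop (𝓝 (Real.pi / 2)) := by
  refine (tendsto_nhds_of_tendsto_nhdsWithin Real.tendsto_arctan_atTop).comp ?_
  refine Tendsto.atTop_div_const hs (tendsto_atTop_add_const_right _ _ ?_)
  exact tendsto_natCast_atTop_atTop.const_mul_atTop (by positivity)

/-- The angle relation is applied to the coefficients `a x`, `±b`, `c / x`, whose discriminant is
that of the original form. -/
theorem pi_sub_arctan_sub_arctan {a b c s x : ℝ} (ha : 0 < a) (hs : 0 < s)
    (h : s ^ 2 = 4 * a * c - b ^ 2) (hx : 0 < x) :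
    Real.pi - Real.arctan ((2 * c / x + b) / s) - Real.arctan ((2 * c / x - b) / s)
      = angleSum a b s x := by
  have e1 := arctan_add_arctan_eq (a := a * x) (b := b) (c := c / x) (by positivity) hs
    (by field_simp; linear_combination h)
  have e2 := arctan_add_arctan_eq (a := a * x) (b := -b) (c := c / x) (by positivity) hs
    (by field_simp; linear_combination h)
  rw [neg_div, Real.arctan_neg] at e2
  rw [angleSum, show 2 * c / x = 2 * (c / x) by ring, show 2 * a * x = 2 * (a * x) by ring,
    sub_eq_add_neg (2 * (c / x)), sub_eq_add_neg (2 * (a * x))]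
  linarith

theorem exists_abs_column_tail_sub_le {a b c s : ℝ} (ha : 0 < a) (hc : 0 < c) (hs : 0 < s)
    (h : s ^ 2 = 4 * a * c - b ^ 2) {S : ℕ → ℝ}
    (hS : ∀ j : ℕ, 1 ≤ j → Tendsto (fun N : ℕ => ∑ k ∈ Finset.Ico 1 N,
      (1 / (a * (j : ℝ) ^ 2 - b * j * k + c * (k : ℝ) ^ 2)
        + 1 / (a * (j : ℝ) ^ 2 + b * j * k + c * (k : ℝ) ^ 2))) atTop (𝓝 (S j))) :
    ∃ C : ℝ, ∀ n j : ℕ, 1 ≤ j → j < n →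
      |S j - ∑ k ∈ Finset.Ico 1 n, (1 / (a * (j : ℝ) ^ 2 - b * j * k + c * (k : ℝ) ^ 2)
          + 1 / (a * (j : ℝ) ^ 2 + b * j * k + c * (k : ℝ) ^ 2))
        - 1 / s * (1 / n * (2 * angleSlope a b s (j / n)))| ≤ C / (n : ℝ) ^ 2 := by
  obtain ⟨C₁, hC₁⟩ := exists_abs_column_sum_sub_le ha hc hs h
  obtain ⟨C₂, hC₂⟩ := exists_abs_column_sum_sub_le (b := -b) ha hc hs (by linear_combination h)
  refine ⟨C₁ + C₂, fun n j hj hjn => ?_⟩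
  have hj0 : (0 : ℝ) < j := by exact_mod_cast hj
  have hn0 : (0 : ℝ) < n := by exact_mod_cast (by omega : 0 < n)
  set f : ℕ → ℝ := fun k => 1 / (a * (j : ℝ) ^ 2 - b * j * k + c * (k : ℝ) ^ 2)
          + 1 / (a * (j : ℝ) ^ 2 + b * j * k + c * (k : ℝ) ^ 2) with hf
  set A : ℝ → ℕ → ℝ := fun b N => 2 / (s * j) * Real.arctan ((2 * c * N + b * j) / (s * j)) with hA
  have hAlim : ∀ b, Tendsto (A b) atTop (𝓝 (2 / (s * j) * (Real.pi / 2))) := fun b =>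
    (tendsto_arctan_linear c (b * j) (s * j) hc (by positivity)).const_mul _
  have hval : 2 / (s * j) * (Real.pi / 2) - A b n + (2 / (s * j) * (Real.pi / 2) - A (-b) n)
      = 1 / s * (1 / n * (2 * angleSlope a b s (j / n))) := by
    rw [angleSlope_of_ne (by positivity), ← pi_sub_arctan_sub_arctan ha hs h (by positivity)]
    simp only [hA]
    rw [show (2 * c * n + b * j) / (s * j) = (2 * c / (j / n) + b) / s by field_simp,
      show (2 * c * n + -b * j) / (s * j) = (2 * c / (j / n) - b) / s by field_simp; ring]
    field_simp
    ring
  have hlim : Tendsto (fun N : ℕ => |(∑ k ∈ Finset.Ico 1 N, f k) - ∑ k ∈ Finset.Ico 1 n, f k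
      - ((A b N - A b n) + (A (-b) N - A (-b) n))|) atTop
      (𝓝 |S j - ∑ k ∈ Finset.Ico 1 n, f k
        - 1 / s * (1 / n * (2 * angleSlope a b s (j / n)))|) := by
    rw [← hval]
    exact (((hS j hj).sub_const _).sub
      (((hAlim b).sub_const _).add ((hAlim (-b)).sub_const _))).abs
  refine le_of_tendsto hlim ?_
  filter_upwards [eventually_ge_atTop n] with N hN
  have h1 := hC₁ n j hj hjn N hN
  have h2 := hC₂ n j hj hjn N hN
  rw [← Finset.sum_Ico_consecutive f (by omega : 1 ≤ n) hN, add_sub_cancel_left]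
  simp only [hf, Finset.sum_add_distrib]
  simp only [neg_mul, ← sub_eq_add_neg] at h2
  simp only [hA, neg_mul, ← sub_eq_add_neg]
  refine le_trans (le_of_eq (congrArg abs ?_)) ((abs_add_le _ _).trans
    ((add_le_add h1 h2).trans_eq (add_div _ _ _).symm))
  ring

/-- Comparison of `G` with the sum over the strip `1 ≤ j < n`, `1 ≤ k`. -/
theorem tendsto_sum_sub_G {a b c s : ℝ} (ha : 0 < a) (hc : 0 < c) (hs : 0 < s)
    (h : s ^ 2 = 4 * a * c - b ^ 2) (hsd : Real.sqrt |disc a b c| = s) {S : ℕ → ℝ}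
    (hS : ∀ j : ℕ, 1 ≤ j → Tendsto (fun N : ℕ => ∑ k ∈ Finset.Ico 1 N,
      (1 / (a * (j : ℝ) ^ 2 - b * j * k + c * (k : ℝ) ^ 2)
        + 1 / (a * (j : ℝ) ^ 2 + b * j * k + c * (k : ℝ) ^ 2))) atTop (𝓝 (S j))) :
    Tendsto (fun n : ℕ => ∑ j ∈ Finset.Ico 1 n, S j - G a b c n) atTop
      (𝓝 (1 / s * (clausenSum a b c
        - (Real.pi / 2 - Real.arctan ((c - a) / s)) * Real.log (c / a)))) := by
  obtain ⟨C, hC⟩ := exists_abs_column_tail_sub_le ha hc hs h hS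
  have hmain := (tendsto_sum_angleSlope ha hc hs h hsd).const_mul (1 / s)
  refine hmain.congr_dist ?_
  refine squeeze_zero' (Eventually.of_forall fun _ => dist_nonneg) (g := fun n : ℕ => |C| / n) ?_
    (tendsto_const_div_atTop_nhds_zero_nat _)
  filter_upwards [eventually_ge_atTop 1] with n hn
  have hn0 : (0 : ℝ) < n := by exact_mod_cast hn
  rw [dist_comm, Real.dist_eq, G, ← Finset.sum_sub_distrib, Finset.mul_sum, Finset.mul_sum,
    ← Finset.sum_sub_distrib]
  refine (Finset.abs_sum_le_sum_abs _ _).trans ?_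
  -- Fewer than `n` columns, each with error `O(n⁻²)`, contribute `O(1/n)` in total.
  refine (Finset.sum_le_card_nsmul _ _ (|C| / (n : ℝ) ^ 2) fun j hj => ?_).trans ?_
  · rw [Finset.mem_Ico] at hj
    exact (hC n j hj.1 hj.2).trans (by gcongr; exact le_abs_self C)
  · rw [Nat.card_Ico, nsmul_eq_mul]
    calc ((n - 1 : ℕ) : ℝ) * (|C| / (n : ℝ) ^ 2) ≤ n * (|C| / (n : ℝ) ^ 2) := by
          gcongr; omega
      _ = |C| / n := by field_simp

/-! ### Column sums and the eta function -/

theorem mu_re {a b c s : ℝ} (hsd : Real.sqrt |disc a b c| = s) : (mu a b c).re = -b / (2 * c) := by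
  rw [mu, hsd, show (2 * (c : ℂ)) = ((2 * c : ℝ) : ℂ) by push_cast; rfl, Complex.div_ofReal_re]
  simp

theorem mu_im {a b c s : ℝ} (hsd : Real.sqrt |disc a b c| = s) : (mu a b c).im = s / (2 * c) := by
  rw [mu, hsd, show (2 * (c : ℂ)) = ((2 * c : ℝ) : ℂ) by push_cast; rfl, Complex.div_ofReal_im]
  simp

theorem im_one_div_mul_mu_sub {a b c s : ℝ} (hc : 0 < c) (hs : 0 < s)
    (h : s ^ 2 = 4 * a * c - b ^ 2) (hsd : Real.sqrt |disc a b c| = s) {x : ℝ} (hx : 0 < x)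
    (y : ℝ) : (1 / ((x : ℂ) * mu a b c - y)).im
      = -(x * s / 2) * (1 / (a * x ^ 2 + b * x * y + c * y ^ 2)) := by
  have hQ := quadForm_pos hc hs h hx y
  have hn : Complex.normSq ((x : ℂ) * mu a b c - y) = (a * x ^ 2 + b * x * y + c * y ^ 2) / c := by
    rw [Complex.normSq_apply]
    simp only [Complex.sub_re, Complex.sub_im, Complex.re_ofReal_mul, Complex.im_ofReal_mul,
      Complex.ofReal_re, Complex.ofReal_im, mu_re hsd, mu_im hsd]
    field_simp
    linear_combination x ^ 2 * h
  rw [one_div, Complex.inv_im, hn]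
  simp only [Complex.sub_im, Complex.im_ofReal_mul, Complex.ofReal_im, mu_im hsd]
  field_simp
  ring

/-- The nome `exp (2 π i μ)`. -/
noncomputable def nome (a b c : ℝ) : ℂ := Complex.exp (2 * Real.pi * Complex.I * mu a b c)

theorem mu_im_pos {a b c s : ℝ} (hc : 0 < c) (hs : 0 < s) (hsd : Real.sqrt |disc a b c| = s) :
    0 < (mu a b c).im := by
  rw [mu_im hsd]; positivity

theorem norm_nome_lt_one {a b c s : ℝ} (hc : 0 < c) (hs : 0 < s)
    (hsd : Real.sqrt |disc a b c| = s) : ‖nome a b c‖ < 1 :=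
  UpperHalfPlane.norm_exp_two_pi_I_lt_one ⟨mu a b c, mu_im_pos hc hs hsd⟩

/-- This is the imaginary part of the partial fraction expansion of `π cot(πw)` at `w = jμ`. The
poles at `±k` give the two signs of `b`, the separate pole term `1/w` gives `-1/(a j²)`, and the
expansion of the cotangent in powers of the nome gives the rest. -/
theorem tendsto_column_sum {a b c s : ℝ} (hc : 0 < c) (hs : 0 < s)
    (h : s ^ 2 = 4 * a * c - b ^ 2) (hsd : Real.sqrt |disc a b c| = s) {j : ℕ} (hj : 1 ≤ j) :
    Tendsto (fun N : ℕ => ∑ k ∈ Finset.Ico 1 N,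
      (1 / (a * (j : ℝ) ^ 2 - b * j * k + c * (k : ℝ) ^ 2)
        + 1 / (a * (j : ℝ) ^ 2 + b * j * k + c * (k : ℝ) ^ 2))) atTop
      (𝓝 (2 * Real.pi / s * (1 / j)
        + 4 * Real.pi / s * (1 / j * (nome a b c ^ j / (1 - nome a b c ^ j)).re)
        - 1 / a * (1 / (j : ℝ) ^ 2))) := by
  have hj0 : (0 : ℝ) < j := by exact_mod_cast hj
  set w : ℂ := ((j : ℝ) : ℂ) * mu a b c with hw
  have hwim : 0 < w.im := by
    rw [hw, Complex.im_ofReal_mul]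
    exact mul_pos hj0 (mu_im_pos hc hs hsd)
  let W : UpperHalfPlane := ⟨w, hwim⟩
  have hWc : (w : ℂ) ∈ Complex.integerComplement := UpperHalfPlane.coe_mem_integerComplement W
  have hq : Complex.exp (2 * Real.pi * Complex.I * w) = nome a b c ^ j := by
    rw [nome, ← Complex.exp_nat_mul, hw]
    congr 1
    push_cast
    ring
  have hqn : ‖nome a b c ^ j‖ < 1 := by
    rw [norm_pow]
    exact pow_lt_one₀ (norm_nonneg _) (norm_nome_lt_one hc hs hsd) (by omega)
  have hq1 : 1 - nome a b c ^ j ≠ 0 := by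
    intro h0
    rw [← sub_eq_zero.1 h0, norm_one] at hqn
    exact lt_irrefl _ hqn
  have hcot : Real.pi * Complex.cot (Real.pi * w) = -(Real.pi * Complex.I)
      - 2 * Real.pi * Complex.I * (nome a b c ^ j / (1 - nome a b c ^ j)) := by
    have := pi_mul_cot_pi_q_exp W
    change Real.pi * Complex.cot (Real.pi * w) = Real.pi * Complex.I - 2 * Real.pi * Complex.I *
      ∑' n : ℕ, Complex.exp (2 * Real.pi * Complex.I * w) ^ n at this
    rw [this, hq, tsum_geometric_of_norm_lt_one hqn]
    field_simp
    ring
  have hsum := (Complex.continuous_im.tendsto _).comp (tendsto_logDeriv_euler_cot_sub hWc)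
  have himw : (1 / w).im = -(j * s / 2) * (1 / (a * (j : ℝ) ^ 2)) := by
    have := im_one_div_mul_mu_sub hc hs h hsd hj0 0
    simpa [hw] using this
  have hlim : -(2 / (j * s)) * (Real.pi * Complex.cot (Real.pi * w) - 1 / w).im
      = 2 * Real.pi / s * (1 / j)
        + 4 * Real.pi / s * (1 / j * (nome a b c ^ j / (1 - nome a b c ^ j)).re)
        - 1 / a * (1 / (j : ℝ) ^ 2) := by
    rw [Complex.sub_im, himw, hcot]
    have e : (-(Real.pi * Complex.I)
        - 2 * Real.pi * Complex.I * (nome a b c ^ j / (1 - nome a b c ^ j))).im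
        = -Real.pi - 2 * Real.pi * (nome a b c ^ j / (1 - nome a b c ^ j)).re := by
      rw [mul_assoc, mul_assoc, Complex.sub_im, Complex.neg_im, Complex.im_ofReal_mul,
        show (2 : ℂ) = ((2 : ℝ) : ℂ) by norm_num, Complex.im_ofReal_mul, Complex.im_ofReal_mul,
        Complex.I_mul_im, Complex.I_im]
      ring
    rw [e]
    field_simp
    ring
  rw [← hlim, ← tendsto_add_atTop_iff_nat 1]
  refine (hsum.const_mul _).congr fun N => ?_
  rw [Function.comp_apply, Complex.im_sum, Finset.mul_sum, Finset.sum_Ico_eq_sum_range,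
    Nat.add_sub_cancel]
  refine Finset.sum_congr rfl fun k _ => ?_
  have e1 := im_one_div_mul_mu_sub hc hs h hsd hj0 ((k : ℝ) + 1)
  have e2 := im_one_div_mul_mu_sub hc hs h hsd hj0 (-((k : ℝ) + 1))
  push_cast at e1 e2
  rw [sub_neg_eq_add] at e2
  rw [cotTerm, Complex.add_im, hw]
  push_cast
  rw [e1, e2, show a * (j : ℝ) ^ 2 + b * j * -((k : ℝ) + 1) + c * (-((k : ℝ) + 1)) ^ 2
    = a * (j : ℝ) ^ 2 - b * j * (1 + k) + c * (1 + (k : ℝ)) ^ 2 by ring, add_comm (k : ℝ) 1]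
  field_simp
  ring

/-- The absolutely convergent double series `∑ q^((m+1)(j+1)) / (j+1)` is summed in both orders:
over `j` it is a logarithm, over `m` a geometric series. -/
theorem hasSum_pow_div_one_sub_pow {q : ℂ} (hq : ‖q‖ < 1) :
    HasSum (fun j : ℕ => 1 / ((j : ℝ) + 1) * (q ^ (j + 1) / (1 - q ^ (j + 1))).re)
      (-∑' m : ℕ, Real.log ‖1 - q ^ (m + 1)‖) := by
  have hpow : ∀ m : ℕ, ‖q ^ (m + 1)‖ < 1 := fun m => by
    rw [norm_pow]; exact pow_lt_one₀ (norm_nonneg _) hq (by omega)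
  let F : ℕ × ℕ → ℂ := fun p => (q ^ (p.1 + 1)) ^ (p.2 + 1) / ((p.2 : ℂ) + 1)
  have hF : Summable F := by
    have hgeo := summable_geometric_of_lt_one (norm_nonneg q) hq
    refine Summable.of_norm_bounded (hgeo.mul_of_nonneg hgeo
      (fun _ => by positivity) (fun _ => by positivity)) fun p => ?_
    have hden : (1 : ℝ) ≤ ‖(p.2 : ℂ) + 1‖ := by
      rw [show (p.2 : ℂ) + 1 = ((p.2 + 1 : ℕ) : ℂ) by push_cast; rfl, Complex.norm_natCast]
      exact_mod_cast Nat.le_add_left 1 p.2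
    simp only [F]
    rw [norm_div, ← pow_mul, norm_pow, ← pow_add]
    refine (div_le_self (by positivity) hden).trans ?_
    exact pow_le_pow_of_le_one (norm_nonneg _) hq.le (by nlinarith)
  have hrow : ∀ m, HasSum (fun j => F (m, j)) (-Complex.log (1 - q ^ (m + 1))) := fun m => by
    have := Complex.hasSum_taylorSeries_neg_log (hpow m)
    rw [← hasSum_nat_add_iff' 1] at this
    simpa [F] using this
  have hcol : ∀ j, HasSum (fun m => F (m, j))
      (1 / ((j : ℂ) + 1) * (q ^ (j + 1) / (1 - q ^ (j + 1)))) := fun j => by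
    have hg := ((hasSum_geometric_of_norm_lt_one (hpow j)).mul_left
      (q ^ (j + 1))).mul_left (1 / ((j : ℂ) + 1))
    rw [div_eq_mul_inv (q ^ (j + 1))]
    refine hg.congr_fun fun m => ?_
    simp only [F]
    rw [← pow_mul, mul_comm (m + 1), pow_mul, pow_succ]
    ring
  have h1 := hF.hasSum.prod_fiberwise hrow
  have h2 := (((Equiv.prodComm ℕ ℕ).hasSum_iff).2 hF.hasSum).prod_fiberwise
    (f := F ∘ Equiv.prodComm ℕ ℕ) hcol
  have h1' := Complex.hasSum_re h1
  have h2' := Complex.hasSum_re h2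
  simp only [Complex.neg_re, Complex.log_re] at h1'
  rw [← tsum_neg, h1'.tsum_eq]
  refine h2'.congr_fun fun j => ?_
  rw [show 1 / ((j : ℂ) + 1) = ((1 / ((j : ℝ) + 1) : ℝ) : ℂ) by push_cast; rfl,
    Complex.re_ofReal_mul]

/-- The additive term compensates the prefactor of `η`, whose norm is `exp(-2π Im μ / 24)` with `Im
μ = s/(2c)`. -/
theorem tsum_log_norm_one_sub_nome {a b c s : ℝ} (hc : 0 < c) (hs : 0 < s)
    (hsd : Real.sqrt |disc a b c| = s) :
    ∑' m : ℕ, Real.log ‖1 - nome a b c ^ (m + 1)‖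
      = Real.log ‖ModularForm.eta (mu a b c)‖ + Real.pi * s / (24 * c) := by
  have hq := norm_nome_lt_one hc hs hsd
  have hz : mu a b c ∈ UpperHalfPlane.upperHalfPlaneSet := mu_im_pos hc hs hsd
  have heq : ∀ m : ℕ, 1 - ModularForm.eta_q m (mu a b c) = 1 - nome a b c ^ (m + 1) := fun m => by
    rw [ModularForm.eta_q_eq_pow, nome]
  have hne : ∀ m : ℕ, 0 < ‖1 - nome a b c ^ (m + 1)‖ := fun m => by
    rw [← heq, norm_pos_iff]
    exact ModularForm.one_sub_eta_q_ne_zero m hz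
  have hsumm : Summable fun m : ℕ => Real.log ‖1 - nome a b c ^ (m + 1)‖ := by
    have : Summable fun m : ℕ => ‖-nome a b c ^ (m + 1)‖ := by
      simpa using (summable_nat_add_iff 1).2 (summable_geometric_of_lt_one (norm_nonneg _) hq)
    simpa [sub_eq_add_neg] using this.summable_log_norm_one_add
  have hprod : ‖∏' m : ℕ, (1 - nome a b c ^ (m + 1))‖
      = Real.exp (∑' m : ℕ, Real.log ‖1 - nome a b c ^ (m + 1)‖) := by
    rw [Real.rexp_tsum_eq_tprod hne hsumm,
      (ModularForm.multipliable_one_sub_pow hq).norm_tprod]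
  rw [ModularForm.eta, tprod_congr heq, norm_mul, hprod, Function.Periodic.norm_qParam,
    Real.log_mul (Real.exp_pos _).ne' (Real.exp_pos _).ne', Real.log_exp, Real.log_exp, mu_im hsd]
  field_simp
  ring

/-- The Kronecker limit formula over the strips `1 ≤ j < n`. -/
theorem tendsto_sum_column_sums {a b c s : ℝ} (hc : 0 < c) (hs : 0 < s)
    (hsd : Real.sqrt |disc a b c| = s) :
    Tendsto (fun n : ℕ => ∑ j ∈ Finset.Ico 1 n, (2 * Real.pi / s * (1 / (j : ℝ))
        + 4 * Real.pi / s * (1 / j * (nome a b c ^ j / (1 - nome a b c ^ j)).re)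
        - 1 / a * (1 / (j : ℝ) ^ 2)) - 2 * Real.pi / s * Real.log n) atTop
      (𝓝 (2 * Real.pi / s * Real.eulerMascheroniConstant
        + 4 * Real.pi / s * -(Real.log ‖ModularForm.eta (mu a b c)‖ + Real.pi * s / (24 * c))
        - 1 / a * (Real.pi ^ 2 / 6))) := by
  rw [← tendsto_add_atTop_iff_nat 1, ← tsum_log_norm_one_sub_nome hc hs hsd]
  have h1 := Real.tendsto_harmonic_sub_log_add_one.const_mul (2 * Real.pi / s)
  have h2 := (hasSum_pow_div_one_sub_pow
    (norm_nome_lt_one hc hs hsd)).tendsto_sum_nat.const_mul (4 * Real.pi / s)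
  have h3 := (((hasSum_nat_add_iff' 1).2 hasSum_zeta_two).tendsto_sum_nat).const_mul (1 / a)
  rw [Finset.sum_range_one, Nat.cast_zero, zero_pow two_ne_zero, div_zero, sub_zero] at h3
  refine ((h1.add h2).sub h3).congr fun n => ?_
  rw [Finset.sum_Ico_eq_sum_range, Nat.add_sub_cancel, Finset.sum_sub_distrib,
    Finset.sum_add_distrib, ← Finset.mul_sum, ← Finset.mul_sum, ← Finset.mul_sum, harmonic]
  push_cast
  simp only [add_comm (1 : ℕ), add_comm (1 : ℝ), one_div]
  ring

/-- The strip limit minus the excess limit. The `π²/(6c)` in the constant comes from the prefactor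
of `η`, and the `π²/(6a)` from `ζ(2)`. -/
theorem tendsto_G_sub_log {a b c s : ℝ} (ha : 0 < a) (hc : 0 < c) (hs : 0 < s)
    (h : s ^ 2 = 4 * a * c - b ^ 2) (hsd : Real.sqrt |disc a b c| = s) :
    Tendsto (fun n : ℕ => G a b c n - 2 * Real.pi / s * Real.log n) atTop (𝓝 (coeff0 a b c)) := by
  have key := (tendsto_sum_column_sums (a := a) (b := b) hc hs hsd).sub
    (tendsto_sum_sub_G ha hc hs h hsd (fun j hj => tendsto_column_sum hc hs h hsd hj))
  refine (key.congr fun n => ?_).trans_eq ?_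
  · ring
  · congr 1
    rw [coeff0, hsd]
    field_simp
    ring

end QuadFormSum

theorem theorem3 (a b c : ℝ) (hpos : QuadFormSum.IsPosDef a b c)
    (hd : QuadFormSum.disc a b c < 0) :
    (fun n : ℕ => QuadFormSum.G a b c n
        - (2 * Real.pi / Real.sqrt |QuadFormSum.disc a b c| * Real.log (n : ℝ)
            + QuadFormSum.coeff0 a b c
            + QuadFormSum.coeff1 a b c * (1 / (n : ℝ))
            + QuadFormSum.coeff2 a b c * (1 / (n : ℝ) ^ 2)
            + QuadFormSum.coeff3 a b c * (1 / (n : ℝ) ^ 3)))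
      =O[Filter.atTop] (fun n : ℕ => Real.log (n : ℝ) / (n : ℝ) ^ 4) := by
  open Filter Topology QuadFormSum in
  have ha : 0 < a := by simpa [form] using hpos 1 0 (by simp)
  have hc : 0 < c := by simpa [form] using hpos 0 1 (by simp)
  obtain ⟨s, hsd⟩ : ∃ s, Real.sqrt |disc a b c| = s := ⟨_, rfl⟩
  have hs : 0 < s := by rw [← hsd]; exact Real.sqrt_pos.2 (abs_pos.2 hd.ne)
  have h : s ^ 2 = 4 * a * c - b ^ 2 := by
    rw [← hsd, Real.sq_sqrt (abs_nonneg _), abs_of_neg hd, disc]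
    ring
  have hpow : ∀ m : ℕ, m ≠ 0 → Tendsto (fun n : ℕ => 1 / (n : ℝ) ^ m) atTop (𝓝 0) :=
    fun m hm => by
      simpa [hm] using (tendsto_one_div_atTop_nhds_zero_nat (𝕜 := ℝ)).pow m
  have hE : Tendsto (fun n : ℕ => G a b c n - (2 * Real.pi / s * Real.log (n : ℝ)
        + coeff1 a b c * (1 / (n : ℝ)) + coeff2 a b c * (1 / (n : ℝ) ^ 2)
        + coeff3 a b c * (1 / (n : ℝ) ^ 3))) atTop (𝓝 (coeff0 a b c)) := by
    have := (((tendsto_G_sub_log ha hc hs h hsd).sub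
      ((hpow 1 one_ne_zero).const_mul (coeff1 a b c))).sub
      ((hpow 2 two_ne_zero).const_mul (coeff2 a b c))).sub
      ((hpow 3 three_ne_zero).const_mul (coeff3 a b c))
    simp only [mul_zero, sub_zero, pow_one] at this
    exact this.congr fun n => by ring
  have hO := isBigO_sub_of_tendsto_of_isBigO_increment hE (isBigO_increment ha hc hs h hsd)
  rw [hsd]
  -- The error obtained is `O(n⁻⁴)`, and the logarithm is a weakening, valid since `log n ≥ 1` for
  -- `n ≥ 3`.
  refine (hO.congr_left fun n => by ring).trans ?_
  refine Asymptotics.IsBigO.of_bound 1 ?_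
  filter_upwards [eventually_ge_atTop 3] with n hn
  have hlog : 1 ≤ Real.log n := by
    rw [Real.le_log_iff_exp_le (by positivity)]
    exact Real.exp_one_lt_three.le.trans (by exact_mod_cast hn)
  rw [one_mul, norm_div, norm_div, norm_one, Real.norm_of_nonneg (by linarith : 0 ≤ Real.log n)]
  gcongr
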